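/- Let $P$ be a finite set of $n$ points in the plane, given in an R-tree with parameters $2\le \mathsf m\le\lceil \mathsf M/2\rceil$: all leaves are on the same level and each point of $P$ is stored exactly once in the leaves; every internal node consists of entries (rectangle, child node), where the rectangle is the minimum bounding axis-aligned rectangle (MBR) of the rectangles (or points) stored in the child node; the root is an internal node with at least two entries, and every other node has between $\mathsf m$ and $\mathsf M$ entries. For a rectangle $N$, let $\mathrm{NE}(N)$ and $\mathrm{SW}(N)$ be the sets of points of $N$ on or above, respectively on or below, the diagonal joining the top-left and bottom-right vertices, and let $\mathrm{NW}(N)$ and $\mathrm{SE}(N)$ be the sets of points of $N$ on or above, respectively on or below, the diagonal joining the bottom-left and top-right vertices. (For $N$ a vertical or horizontal segment, each of these four sets is $N$.) Let $v_1,v_2,v_3,v_4$ be the top-left, bottom-left, bottom-right and top-right vertices of the MBR of $P$, which is computed as the MBR of the rectangles in the root. The algorithm ConvexHull$(P)$ starts with $N_P$ the collection of the entries (rectangles) of the root. As long as $N_P$ is made of rectangles it computes $$C_1=\mathrm{conv}\Bigl(\bigcup_{N\in N_P}\mathrm{SE}(N)\cup\{v_2,v_3,v_4\}\Bigr),\qquad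 C_2=\mathrm{conv}\Bigl(\bigcup_{N\in N_P}\mathrm{NE}(N)\cup\{v_1,v_3,v_4\}\Bigr),$$ $$C_3=\mathrm{conv}\Bigl(\bigcup_{N\in N_P}\mathrm{NW}(N)\cup\{v_1,v_2,v_4\}\Bigr),\qquad C_4=\mathrm{conv}\Bigl(\bigcup_{N\in N_P}\mathrm{SW}(N)\cup\{v_1,v_2,v_3\}\Bigr),$$ discards from $N_P$ every rectangle $N\subseteq C_1\cap C_2\cap C_3\cap C_4$, and replaces each remaining rectangle by the rectangles (or points) in its child node. When $N_P$ is made of points, it returns $\mathrm{conv}(N_P)$. Consider the following implementation on a unit-cost real RAM. A convex hull is computed from the vertices of the triangles by merge sort and the monotone chain method. A rectangle is discarded if and only if its top-left, bottom-left, bottom-right and top-right vertices belong to $C_1,C_2,C_3,C_4$, respectively, each membership being decided by binary search on the boundary of the hull. Then: 1. At every level the implementation keeps exactly the rectangles of $N_P$ that are not contained in $C_1\cap C_2\cap C_3\cap C_4$, it reaches the same final set of points $N_P$ as the algorithm, and it outputs the vertices of $\mathrm{conv}(N_P)$, each once, in counterclockwise order. 2. If all rectangles of the R-tree have positive width and positive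 height, then $\mathrm{conv}(N_P)=\mathrm{conv}(P)$ for the final $N_P$; so the algorithm returns $\mathrm{conv}(P)$, as the counterclockwise list of its vertices. 3. There is an absolute constant $C$ (independent of $P$, of the R-tree and of $\mathsf m,\mathsf M$) such that the number of steps is at most $C\,n\log n$. -/

import Mathlib

/-! ## Points, rectangles and R-trees -/

/-- Points of the plane. -/
abbrev Pt : Type := ℝ × ℝ

/-- An axis-aligned rectangle, given by its bottom-left and top-right vertices. -/
structure Rect where
  lo : Pt
  hi : Pt

namespace Rect

/-- The set of points of the rectangle (the order on `ℝ × ℝ` is coordinatewise). -/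
def region (r : Rect) : Set Pt := Set.Icc r.lo r.hi

/-- Top-left vertex. -/
def tl (r : Rect) : Pt := (r.lo.1, r.hi.2)
/-- Bottom-left vertex. -/
def bl (r : Rect) : Pt := r.lo
/-- Bottom-right vertex. -/
def br (r : Rect) : Pt := (r.hi.1, r.lo.2)
/-- Top-right vertex. -/
def tr (r : Rect) : Pt := r.hi

/-- The rectangle has positive width and positive height. -/
def Proper (r : Rect) : Prop := r.lo.1 < r.hi.1 ∧ r.lo.2 < r.hi.2

end Rect

/-- Minimum bounding rectangle of a nonempty bounded set. -/
noncomputable def mbr (X : Set Pt) : Rect :=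
  ⟨(sInf (Prod.fst '' X), sInf (Prod.snd '' X)), (sSup (Prod.fst '' X), sSup (Prod.snd '' X))⟩

/-- What a node of an R-tree stores.  `Item 0` is an indexed point, an entry of a leaf.
`Item (h + 1)` is an entry `(MBR, ref)` of an inner node: a rectangle and the child node, a node
being the list of its entries.  The index makes the tree height balanced: all leaves of the
subtree below an `Item (h + 1)` are at the same depth. -/
def Item : ℕ → Type
  | 0 => Pt
  | h + 1 => Rect × List (Item h)

namespace Item

/-- The rectangle of an entry of an inner node. -/
def rect {h : ℕ} (e : Item (h + 1)) : Rect := Prod.fst (β := List (Item h)) e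

/-- The entries (rectangles or points) of the child node of an entry. -/
def children {h : ℕ} (e : Item (h + 1)) : List (Item h) := Prod.snd (α := Rect) e

/-- The part of the plane that an item occupies. -/
def region : (h : ℕ) → Item h → Set Pt
  | 0, p => {(p : Pt)}
  | _ + 1, e => (rect e).region

/-- The part of the plane that a list of items occupies. -/
def cover {h : ℕ} (l : List (Item h)) : Set Pt := ⋃ x ∈ l, region h x

/-- The points stored in the leaves below an item. -/
def points : (h : ℕ) → Item h → List Pt
  | 0, p => [(p : Pt)]
  | h + 1, e => (children e).flatMap (points h)

/-- Every node below has between `m` and `M` entries, and every rectangle is the minimum bounding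
rectangle of the rectangles (or points) in the child node. -/
def Valid (m M : ℕ) : (h : ℕ) → Item h → Prop
  | 0, _ => True
  | h + 1, e => m ≤ (children e).length ∧ (children e).length ≤ M ∧
      rect e = mbr (cover (children e)) ∧ ∀ x ∈ children e, Valid m M h x

/-- All rectangles stored in the item and below it have positive width and height. -/
def AllProper : (h : ℕ) → Item h → Prop
  | 0, _ => True
  | h + 1, e => (rect e).Proper ∧ ∀ x ∈ children e, AllProper h x

end Item

/-- `root` is the root node of an R-tree, with fan-out parameters `m` and `M`, for the finite point
set `P`: the root has at least two children nodes, all other nodes have between `m` and `M` entries,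
and each point of `P` occurs exactly once in the leaves.  The leaves are at level `h + 1`. -/
structure IsRTree (m M : ℕ) (P : Finset Pt) {h : ℕ} (root : List (Item (h + 1))) : Prop where
  two_le : 2 ≤ m
  le_half : m ≤ (M + 1) / 2 -- the ceiling of `M / 2`
  root_two_le : 2 ≤ root.length
  valid : ∀ e ∈ root, e.Valid m M (h + 1)
  nodup : (root.flatMap (Item.points (h + 1))).Nodup
  mem_points : ∀ p, p ∈ root.flatMap (Item.points (h + 1)) ↔ p ∈ P

/-! ## The algorithm, as a procedure on sets -/

/-- Twice the signed area of the triangle `a b c`; positive iff `a, b, c` turn counterclockwise. -/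
def cross (a b c : Pt) : ℝ := (b.1 - a.1) * (c.2 - a.2) - (b.2 - a.2) * (c.1 - a.1)

namespace Rect

/-- Points of the rectangle in or above the diagonal from the top-left to the bottom-right vertex. -/
def NE (r : Rect) : Set Pt := {p ∈ r.region | 0 ≤ cross r.tl r.br p}
/-- Points of the rectangle in or above the diagonal from the bottom-left to the top-right vertex. -/
def NW (r : Rect) : Set Pt := {p ∈ r.region | 0 ≤ cross r.bl r.tr p}
/-- Points of the rectangle in or below the diagonal from the bottom-left to the top-right vertex. -/
def SE (r : Rect) : Set Pt := {p ∈ r.region | cross r.bl r.tr p ≤ 0}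
/-- Points of the rectangle in or below the diagonal from the top-left to the bottom-right vertex. -/
def SW (r : Rect) : Set Pt := {p ∈ r.region | cross r.tl r.br p ≤ 0}

end Rect

/-- The first hull of corner triangles, for the rectangles `N` and the bounding rectangle `B`. -/
def hullC₁ (B : Rect) (N : List Rect) : Set Pt :=
  convexHull ℝ ((⋃ r ∈ N, r.SE) ∪ {B.bl, B.br, B.tr})
/-- The second hull of corner triangles. -/
def hullC₂ (B : Rect) (N : List Rect) : Set Pt :=
  convexHull ℝ ((⋃ r ∈ N, r.NE) ∪ {B.tl, B.br, B.tr})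
/-- The third hull of corner triangles. -/
def hullC₃ (B : Rect) (N : List Rect) : Set Pt :=
  convexHull ℝ ((⋃ r ∈ N, r.NW) ∪ {B.tl, B.bl, B.tr})
/-- The fourth hull of corner triangles. -/
def hullC₄ (B : Rect) (N : List Rect) : Set Pt :=
  convexHull ℝ ((⋃ r ∈ N, r.SW) ∪ {B.tl, B.bl, B.br})

open Classical in
/-- Discard from `N` every entry whose rectangle is contained in all four hulls. -/
noncomputable def discard {h : ℕ} (B : Rect) (N : List (Item (h + 1))) : List (Item (h + 1)) :=
  N.filter fun e => ¬ e.rect.region ⊆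
    hullC₁ B (N.map Item.rect) ∩ hullC₂ B (N.map Item.rect) ∩
      hullC₃ B (N.map Item.rect) ∩ hullC₄ B (N.map Item.rect)

/-- The main loop: discard rectangles, replace the remaining ones by their children, until only
points are left.  Returned are the rectangles that remain after each discarding step, level by
level, and the final list of points. -/
noncomputable def descend (B : Rect) : (h : ℕ) → List (Item h) → List (List Rect) × List Pt
  | 0, N => ([], N)
  | h + 1, N =>
      let K := discard B N
      let R := descend B h (K.flatMap Item.children)
      (K.map Item.rect :: R.1, R.2)

/-- The loop started at the root node, with the bounding rectangle of the root's rectangles. -/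
noncomputable def hullAlgorithm {h : ℕ} (root : List (Item (h + 1))) :
    List (List Rect) × List Pt :=
  descend (mbr (Item.cover root)) (h + 1) root

/-! ## The implementation, with its step count

Computations on a unit-cost real RAM: a value together with the number of elementary steps that
were used.  An arithmetic operation or a comparison of two reals, and an access to an array cell,
cost one step each.  Every procedure call pays at least one further step, which covers the bounded
amount of branching, pattern matching, index arithmetic and allocation of list cells in its body. -/

/-- A value and the number of steps spent to compute it. -/
structure Timed (α : Type) where
  val : α
  steps : ℕ

namespace Timed

instance : Monad Timed where
  pure a := ⟨a, 0⟩
  bind x f := ⟨(f x.val).val, x.steps + (f x.val).steps⟩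

/-- Spend one step. -/
def tick : Timed Unit := ⟨(), 1⟩

noncomputable def sub (x y : ℝ) : Timed ℝ := ⟨x - y, 1⟩
noncomputable def mul (x y : ℝ) : Timed ℝ := ⟨x * y, 1⟩
noncomputable def lt (x y : ℝ) : Timed Bool := ⟨decide (x < y), 1⟩
noncomputable def le (x y : ℝ) : Timed Bool := ⟨decide (x ≤ y), 1⟩

/-- Read an array cell. -/
def get (A : Array Pt) (i : ℕ) : Timed Pt := ⟨A.getD i (0, 0), 1⟩

/-- Write a list into a new array. -/
def toArray (l : List Pt) : Timed (Array Pt) := ⟨l.toArray, l.length + 1⟩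

/-! ### Primitives on points -/

/-- The orientation determinant. -/
noncomputable def cross (a b c : Pt) : Timed ℝ := do
  tick
  let x₁ ← sub b.1 a.1
  let y₁ ← sub c.2 a.2
  let x₂ ← sub b.2 a.2
  let y₂ ← sub c.1 a.1
  let u ← mul x₁ y₁
  let v ← mul x₂ y₂
  sub u v

/-- Lexicographic comparison. -/
noncomputable def lexLe (a b : Pt) : Timed Bool := do
  tick
  if ← lt a.1 b.1 then return true
  if ← lt b.1 a.1 then return false
  le a.2 b.2

/-! ### Lists -/

/-- Reverse the first list onto the second. -/
def revOnto {α : Type} : List α → List α → Timed (List α)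
  | [], acc => do tick; return acc
  | a :: l, acc => do tick; revOnto l (a :: acc)

/-- Concatenation. -/
def append {α : Type} : List α → List α → Timed (List α)
  | [], r => do tick; return r
  | a :: l, r => do
      tick
      let s ← append l r
      return a :: s

/-- Distribute a list alternately over two lists. -/
def split : List Pt → Timed (List Pt × List Pt)
  | [] => do tick; return ([], [])
  | a :: l => do
      tick
      let s ← split l
      return (a :: s.2, s.1)

theorem split_length (l : List Pt) :
    (split l).val.1.length = (l.length + 1) / 2 ∧ (split l).val.2.length = l.length / 2 := by
  induction l with
  | nil => exact ⟨rfl, rfl⟩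
  | cons a l ih =>
    have h1 : (split (a :: l)).val.1 = a :: (split l).val.2 := rfl
    have h2 : (split (a :: l)).val.2 = (split l).val.1 := rfl
    rw [h1, h2]
    simp only [List.length_cons]
    omega

/-- Merge two lexicographically sorted lists. -/
noncomputable def merge : List Pt → List Pt → Timed (List Pt)
  | [], r => do tick; return r
  | a :: l, [] => do tick; return a :: l
  | a :: l, b :: r => do
      tick
      if ← lexLe a b then
        let s ← merge l (b :: r)
        return a :: s
      else
        let s ← merge (a :: l) r
        return b :: s
  termination_by l r => l.length + r.length

/-- Merge sort.  (The two halves are written as `(split _).val` only to make termination visible;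
the cost of computing them is charged once, by the line before.) -/
noncomputable def mergeSort : List Pt → Timed (List Pt)
  | [] => do tick; return []
  | [a] => do tick; return [a]
  | a :: b :: l => do
      tick
      let _ ← split (a :: b :: l)
      let x ← mergeSort (split (a :: b :: l)).val.1
      let y ← mergeSort (split (a :: b :: l)).val.2
      merge x y
  termination_by l => l.length
  decreasing_by
    · rw [(split_length _).1]; simp only [List.length_cons]; omega
    · rw [(split_length _).2]; simp only [List.length_cons]; omega

/-! ### Planar convex hulls by the monotone chain method -/

/-- Remove from the stack the points that make no strict left turn towards `p`. -/
noncomputable def popStack (p : Pt) : List Pt → Timed (List Pt)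
  | [] => do tick; return []
  | [a] => do tick; return [a]
  | b :: a :: s => do
      tick
      let c ← cross a b p
      if ← le c 0 then popStack p (a :: s) else return b :: a :: s

/-- Scan a sorted list of points, keeping a stack of strict left turns. -/
noncomputable def scan : List Pt → List Pt → Timed (List Pt)
  | s, [] => do tick; return s
  | s, p :: l => do
      tick
      let t ← popStack p s
      scan (p :: t) l

/-- The lower and upper chains of the convex hull; the lower one from the lexicographically last to
the first point, the upper one from the first to the last. -/
noncomputable def chains (l : List Pt) : Timed (List Pt × List Pt) := do
  tick
  let s ← mergeSort l
  let lower ← scan [] s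
  let r ← revOnto s []
  let upper ← scan [] r
  return (lower, upper)

/-- The vertices of the convex hull in counterclockwise order. -/
noncomputable def polygon (l : List Pt) : Timed (List Pt) := do
  tick
  match l with
  | [] => return []
  | [p] => return [p]
  | _ =>
    let c ← chains l
    let u ← revOnto c.2.tail []
    revOnto c.1.tail u

/-- The lower and upper chains in two arrays, both in increasing lexicographic order. -/
noncomputable def hullArrays (l : List Pt) : Timed (Array Pt × Array Pt) := do
  tick
  let c ← chains l
  let low ← revOnto c.1 []
  let A ← toArray low
  let B ← toArray c.2
  return (A, B)

/-- Binary search in a lexicographically increasing array between the indices `lo` and `hi`. -/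
noncomputable def search (A : Array Pt) (q : Pt) (lo hi : ℕ) : Timed (ℕ × ℕ) :=
  if _h : hi ≤ lo + 1 then do tick; return (lo, hi)
  else do
    tick
    let a ← get A ((lo + hi) / 2)
    if ← lexLe a q then search A q ((lo + hi) / 2) hi else search A q lo ((lo + hi) / 2)
  termination_by hi - lo

/-- The orientation of `q` with respect to the edge of the chain found by binary search. -/
noncomputable def side (A : Array Pt) (q : Pt) : Timed ℝ := do
  tick
  let i ← search A q 0 (A.size - 1)
  let a ← get A i.1
  let b ← get A i.2
  cross a b q

/-- Does `q` belong to the convex hull with the given chains? -/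
noncomputable def inHull (H : Array Pt × Array Pt) (q : Pt) : Timed Bool := do
  tick
  let a ← get H.1 0
  let z ← get H.1 (H.1.size - 1)
  if ← lexLe a q then
    if ← lexLe q z then
      let c ← side H.1 q
      let d ← side H.2 q
      if ← le 0 c then le d 0 else return false
    else return false
  else return false

/-! ### The R-tree procedure -/

/-- List three chosen vertices of every rectangle. -/
def gather (f g k : Rect → Pt) : List Rect → Timed (List Pt)
  | [] => do tick; return []
  | r :: rs => do
      tick
      let l ← gather f g k rs
      return f r :: g r :: k r :: l

/-- The rectangles of a list of entries. -/
def rects {h : ℕ} : List (Item (h + 1)) → Timed (List Rect)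
  | [] => do tick; return []
  | e :: es => do
      tick
      let l ← rects es
      return e.rect :: l

/-- The children of a list of entries. -/
def children {h : ℕ} : List (Item (h + 1)) → Timed (List (Item h))
  | [] => do tick; return []
  | e :: es => do
      tick
      let l ← children es
      append e.children l

/-- Enlarge a rectangle so that it contains the rectangles of a list. -/
noncomputable def bound : Rect → List Rect → Timed Rect
  | B, [] => do tick; return B
  | B, r :: rs => do
      tick
      let x₀ ← lt r.lo.1 B.lo.1
      let y₀ ← lt r.lo.2 B.lo.2
      let x₁ ← lt B.hi.1 r.hi.1
      let y₁ ← lt B.hi.2 r.hi.2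
      bound ⟨(if x₀ then r.lo.1 else B.lo.1, if y₀ then r.lo.2 else B.lo.2),
        (if x₁ then r.hi.1 else B.hi.1, if y₁ then r.hi.2 else B.hi.2)⟩ rs

/-- The bounding rectangle of a nonempty list of rectangles. -/
noncomputable def boundingRect : List Rect → Timed Rect
  | [] => do tick; return ⟨(0, 0), (0, 0)⟩
  | r :: rs => do tick; bound r rs

/-- Keep the entries whose rectangle has its top-left, bottom-left, bottom-right or top-right vertex
outside the first, second, third or fourth hull, respectively. -/
noncomputable def keep {h : ℕ} (H₁ H₂ H₃ H₄ : Array Pt × Array Pt) :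
    List (Item (h + 1)) → Timed (List (Item (h + 1)))
  | [] => do tick; return []
  | e :: es => do
      tick
      let b₁ ← inHull H₁ e.rect.tl
      let b₂ ← inHull H₂ e.rect.bl
      let b₃ ← inHull H₃ e.rect.br
      let b₄ ← inHull H₄ e.rect.tr
      let l ← keep H₁ H₂ H₃ H₄ es
      if b₁ && b₂ && b₃ && b₄ then return l else return e :: l

/-- Compute the four hulls of corner triangles and discard the entries contained in all of them. -/
noncomputable def discard {h : ℕ} (B : Rect) (N : List (Item (h + 1))) :
    Timed (List (Item (h + 1))) := do
  tick
  let rs ← rects N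
  let H₁ ← hullArrays (← gather Rect.bl Rect.br Rect.tr (B :: rs))
  let H₂ ← hullArrays (← gather Rect.tl Rect.br Rect.tr (B :: rs))
  let H₃ ← hullArrays (← gather Rect.tl Rect.bl Rect.tr (B :: rs))
  let H₄ ← hullArrays (← gather Rect.tl Rect.bl Rect.br (B :: rs))
  keep H₁ H₂ H₃ H₄ N

/-- The main loop. -/
noncomputable def descend (B : Rect) : (h : ℕ) → List (Item h) → Timed (List (List Rect) × List Pt)
  | 0, N => do tick; return ([], N)
  | h + 1, N => do
      tick
      let K ← discard B N
      let rs ← rects K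
      let R ← descend B h (← children K)
      return (rs :: R.1, R.2)

end Timed

/-- The convex hull algorithm on the root node of an R-tree.  The result consists of the rectangles
that remain after each discarding step, level by level, the points that are reached at the leaves,
and the vertices of their convex hull in counterclockwise order. -/
noncomputable def timedConvexHull {h : ℕ} (root : List (Item (h + 1))) :
    Timed ((List (List Rect) × List Pt) × List Pt) := do
  Timed.tick
  let B ← Timed.boundingRect (← Timed.rects root)
  let R ← Timed.descend B (h + 1) root
  let Q ← Timed.polygon R.2
  return (R, Q)

/-- The list `Q` represents the convex polygon `S` (possibly degenerate): it enumerates the vertices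
of `S`, each once, in counterclockwise order. -/
structure Represents (Q : List Pt) (S : Set Pt) : Prop where
  hull_eq : convexHull ℝ {p | p ∈ Q} = S
  mem_iff : ∀ p, p ∈ Q ↔ p ∈ Set.extremePoints ℝ S
  nodup : Q.Nodup
  ccw : Q.Triplewise fun a b c => 0 < cross a b c

/-! Discarding. A corner triangle is the hull of its three vertices, so each `hullC` is the hull of
finitely many rectangle vertices, the bounding rectangle serving as one more rectangle
(`convexHull_iUnion_union_eq`). A rectangle of the list has three vertices in each hull already,
hence lies in all four as soon as the missing vertex does (`region_subset_hulls_iff`). Membership is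
decided on monotone chains: a point is in the hull iff it lies above the lower chain and below the
upper chain, and the edge found by binary search settles each question (`inHull_hullArrays`).
Everything about the upper chain comes from the lower one by the reflection `p ↦ -p`.

Output. On a lexicographically sorted stack, a left turn at the top extends to left turns for all
triples (`cross_pos_trans`, `LeftChain.cons`). Joining both chains gives a list whose triples all
turn left, and such a list enumerates the vertices of its hull (`represents_of_ccw`).

Survival of vertices. Let `p` be a vertex of the hull of `P`, stored below a rectangle `R`. Some
linear functional with two nonzero coefficients is maximal on `P` only at `p`
(`exists_strict_support`); their signs select a corner of `R`, whose value is at least that at `p`.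
Any vertex of another type of a rectangle `r` is dominated by a stored point `q` touching a side of
`r`. Its value is therefore below that at the selected corner of `R`: strictly if `q ≠ p`, and by
positive width and height if `q = p`, since then `r` is `R` itself or the bounding rectangle. So
this corner is outside the hull built without its type, and `R` is kept (`not_region_subset_hulls`).

Cost. An item of height `h` stores at least `2 ^ h` points, so a list at that height has at most `n
/ 2 ^ h` items. A list of length `k` costs `O((k + 1) log n)` by `discard_steps`; the lengths form a
geometric series with sum `O(n)`, and the number of levels is at most `n` (`descend_steps`). -/

/-! ## Sorting -/

/-- The lexicographic order on the plane. -/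
def LexLe (a b : Pt) : Prop := a.1 < b.1 ∨ a.1 = b.1 ∧ a.2 ≤ b.2

theorem LexLe.refl (a : Pt) : LexLe a a := Or.inr ⟨rfl, le_rfl⟩

theorem LexLe.trans {a b c : Pt} (h : LexLe a b) (h' : LexLe b c) : LexLe a c := by
  unfold LexLe at *
  grind

theorem LexLe.total (a b : Pt) : LexLe a b ∨ LexLe b a := by
  unfold LexLe
  grind

theorem LexLe.antisymm {a b : Pt} (h : LexLe a b) (h' : LexLe b a) : a = b := by
  unfold LexLe at *
  ext <;> grind

theorem LexLe.fst_le {a b : Pt} (h : LexLe a b) : a.1 ≤ b.1 := by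
  unfold LexLe at *
  grind

theorem LexLe.neg {a b : Pt} (h : LexLe a b) : LexLe (-b) (-a) := by
  unfold LexLe at *
  simp only [Prod.fst_neg, Prod.snd_neg]
  grind

namespace Timed

@[simp] theorem val_pure {α : Type} (a : α) : (pure a : Timed α).val = a := rfl
@[simp] theorem steps_pure {α : Type} (a : α) : (pure a : Timed α).steps = 0 := rfl
@[simp] theorem val_bind {α β : Type} (x : Timed α) (f : α → Timed β) :
    (x >>= f).val = (f x.val).val := rfl
@[simp] theorem steps_bind {α β : Type} (x : Timed α) (f : α → Timed β) :
    (x >>= f).steps = x.steps + (f x.val).steps := rfl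
@[simp] theorem steps_tick : tick.steps = 1 := rfl
@[simp] theorem val_lt (x y : ℝ) : (lt x y).val = decide (x < y) := rfl
@[simp] theorem steps_lt (x y : ℝ) : (lt x y).steps = 1 := rfl
@[simp] theorem val_le (x y : ℝ) : (le x y).val = decide (x ≤ y) := rfl
@[simp] theorem steps_le (x y : ℝ) : (le x y).steps = 1 := rfl
@[simp] theorem val_get (A : Array Pt) (i : ℕ) : (get A i).val = A.getD i (0, 0) := rfl
@[simp] theorem steps_get (A : Array Pt) (i : ℕ) : (get A i).steps = 1 := rfl
@[simp] theorem val_toArray (l : List Pt) : (toArray l).val = l.toArray := rfl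
@[simp] theorem steps_toArray (l : List Pt) : (toArray l).steps = l.length + 1 := rfl
@[simp] theorem val_cross (a b c : Pt) : (cross a b c).val = _root_.cross a b c := rfl
@[simp] theorem steps_cross (a b c : Pt) : (cross a b c).steps = 8 := rfl

@[simp] theorem val_ite {α : Type} (c : Prop) [Decidable c] (x y : Timed α) :
    (if c then x else y).val = if c then x.val else y.val := by
  split <;> rfl

@[simp] theorem steps_ite {α : Type} (c : Prop) [Decidable c] (x y : Timed α) :
    (if c then x else y).steps = if c then x.steps else y.steps := by
  split <;> rfl

theorem lexLe_val (a b : Pt) : (lexLe a b).val = true ↔ LexLe a b := by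
  simp only [lexLe, val_bind, val_ite, val_pure, val_lt, val_le, decide_eq_true_eq, LexLe]
  grind

theorem lexLe_steps (a b : Pt) : (lexLe a b).steps ≤ 4 := by
  simp only [lexLe, steps_bind, steps_ite, steps_pure, steps_lt, steps_le, steps_tick]
  split_ifs <;> omega

@[simp] theorem revOnto_val {α : Type} (l acc : List α) :
    (revOnto l acc).val = l.reverse ++ acc := by
  induction l generalizing acc with
  | nil => rfl
  | cons a l ih => simp [revOnto, ih]

@[simp] theorem revOnto_steps {α : Type} (l acc : List α) :
    (revOnto l acc).steps = l.length + 1 := by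
  induction l generalizing acc with
  | nil => rfl
  | cons a l ih => simp [revOnto, ih]; omega

@[simp] theorem append_val {α : Type} (l r : List α) : (append l r).val = l ++ r := by
  induction l with
  | nil => rfl
  | cons a l ih => simp [append, ih]

@[simp] theorem append_steps {α : Type} (l r : List α) : (append l r).steps = l.length + 1 := by
  induction l with
  | nil => rfl
  | cons a l ih => simp [append, ih]; omega

theorem split_steps (l : List Pt) : (split l).steps = l.length + 1 := by
  induction l with
  | nil => rfl
  | cons a l ih => simp [split, ih]; omega

theorem split_perm (l : List Pt) : ((split l).val.1 ++ (split l).val.2).Perm l := by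
  induction l with
  | nil => exact List.Perm.refl _
  | cons a l ih =>
    change (a :: (split l).val.2 ++ (split l).val.1).Perm (a :: l)
    exact (List.perm_append_comm.trans ih).cons a

theorem merge_perm (l r : List Pt) : (merge l r).val.Perm (l ++ r) := by
  fun_induction merge l r with
  | case1 r => simp
  | case2 a l => simp
  | case3 a l b r ih₁ ih₂ =>
    simp only [val_bind, val_ite, val_pure]
    split_ifs
    · exact ih₁.cons a
    · exact (ih₂.cons b).trans List.perm_middle.symm

theorem merge_sorted (l r : List Pt) (hl : l.Pairwise LexLe) (hr : r.Pairwise LexLe) :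
    (merge l r).val.Pairwise LexLe := by
  fun_induction merge l r with
  | case1 r => exact hr
  | case2 a l => exact hl
  | case3 a l b r ih₁ ih₂ =>
    simp only [val_bind, val_ite, val_pure]
    rw [List.pairwise_cons] at hl hr
    split_ifs with h
    · rw [lexLe_val] at h
      refine List.pairwise_cons.2 ⟨fun x hx => ?_, ih₁ hl.2 (List.pairwise_cons.2 hr)⟩
      rw [(merge_perm _ _).mem_iff, List.mem_append, List.mem_cons] at hx
      rcases hx with hx | rfl | hx
      · exact hl.1 x hx
      · exact h
      · exact h.trans (hr.1 x hx)
    · rw [lexLe_val] at h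
      have h := (LexLe.total a b).resolve_left h
      refine List.pairwise_cons.2 ⟨fun x hx => ?_, ih₂ (List.pairwise_cons.2 hl) hr.2⟩
      rw [(merge_perm _ _).mem_iff, List.mem_append, List.mem_cons] at hx
      rcases hx with (rfl | hx) | hx
      · exact h
      · exact h.trans (hl.1 x hx)
      · exact hr.1 x hx

theorem merge_steps (l r : List Pt) : (merge l r).steps ≤ 5 * (l.length + r.length) + 1 := by
  fun_induction merge l r with
  | case1 r => simp
  | case2 a l => simp
  | case3 a l b r ih₁ ih₂ =>
    simp only [steps_bind, steps_ite, steps_pure, steps_tick, List.length_cons] at *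
    have := lexLe_steps a b
    split_ifs <;> omega

theorem mergeSort_perm (l : List Pt) : (mergeSort l).val.Perm l := by
  fun_induction mergeSort l with
  | case1 => simp
  | case2 a => simp
  | case3 a b l ih₁ ih₂ =>
    simp only [val_bind]
    exact (merge_perm _ _).trans ((ih₁.append ih₂).trans (split_perm _))

theorem mergeSort_sorted (l : List Pt) : (mergeSort l).val.Pairwise LexLe := by
  fun_induction mergeSort l with
  | case1 => simp
  | case2 a => simp
  | case3 a b l ih₁ ih₂ =>
    simp only [val_bind]
    exact merge_sorted _ _ ih₁ ih₂

theorem mergeSort_steps (l : List Pt) :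
    (mergeSort l).steps ≤ 12 * (l.length * Nat.clog 2 l.length) + 1 := by
  fun_induction mergeSort l with
  | case1 => simp
  | case2 a => simp
  | case3 a b l ih₁ ih₂ =>
    simp only [steps_bind, steps_tick, split_steps]
    have hm := merge_steps (mergeSort (split (a :: b :: l)).val.1).val
      (mergeSort (split (a :: b :: l)).val.2).val
    rw [(mergeSort_perm _).length_eq, (mergeSort_perm _).length_eq] at hm
    rw [(split_length _).1] at ih₁ hm
    rw [(split_length _).2] at ih₂ hm
    have hk : 2 ≤ (a :: b :: l).length := by simp
    generalize (a :: b :: l).length = k at *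
    have hc : Nat.clog 2 k = Nat.clog 2 ((k + 1) / 2) + 1 := by
      exact Nat.clog_of_two_le one_lt_two hk
    have h2 : Nat.clog 2 (k / 2) ≤ Nat.clog 2 ((k + 1) / 2) :=
      Nat.clog_mono_right 2 (Nat.div_le_div_right (Nat.le_succ k))
    generalize Nat.clog 2 ((k + 1) / 2) = c at *
    rw [hc]
    -- Both halves are charged with the logarithm `c` of the larger one. The work at the top is at
    -- most `6 * k + 3`, below the gain `12 * k` from `clog` dropping by one.
    have h3 : k / 2 * Nat.clog 2 (k / 2) ≤ k / 2 * c := Nat.mul_le_mul_left _ h2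
    have h4 : (k + 1) / 2 * c + k / 2 * c = k * c := by
      rw [← Nat.add_mul]; congr 1; omega
    rw [Nat.mul_add]
    omega

end Timed

/-! ## Points above and below a set -/

theorem cross_neg (a b c : Pt) : cross (-a) (-b) (-c) = cross a b c := by
  simp only [cross, Prod.fst_neg, Prod.snd_neg]; ring

theorem cross_rotate (a b c : Pt) : cross a b c = cross b c a := by
  unfold cross; ring

theorem cross_swap (a b c : Pt) : cross a b c = -cross a c b := by
  unfold cross; ring

/-- The points that lie above some point of the convex hull of `S`. -/
def Up (S : Set Pt) : Set Pt := {q | ∃ z ∈ convexHull ℝ S, z.1 = q.1 ∧ z.2 ≤ q.2}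

/-- The points that lie below some point of the convex hull of `S`. -/
def Down (S : Set Pt) : Set Pt := {q | ∃ z ∈ convexHull ℝ S, z.1 = q.1 ∧ q.2 ≤ z.2}

theorem subset_up (S : Set Pt) : S ⊆ Up S := fun q hq =>
  ⟨q, subset_convexHull ℝ S hq, rfl, le_rfl⟩

theorem convex_up (S : Set Pt) : Convex ℝ (Up S) := by
  rintro x ⟨x', hx', h1, h2⟩ y ⟨y', hy', h3, h4⟩ a b ha hb hab
  refine ⟨a • x' + b • y', convex_convexHull ℝ S hx' hy' ha hb hab, ?_, ?_⟩
  · simp [h1, h3]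
  · simp only [Prod.snd_add, Prod.smul_snd, smul_eq_mul]
    gcongr

/-- `Up T` is convex and closed under moving upwards, so `Up` is a closure operator. This allows the
scan to forget popped points. -/
theorem up_subset_up {S T : Set Pt} (h : S ⊆ Up T) : Up S ⊆ Up T := by
  rintro q ⟨z, hz, h1, h2⟩
  obtain ⟨w, hw, h3, h4⟩ := convexHull_min h (convex_up T) hz
  exact ⟨w, hw, h3.trans h1, h4.trans h2⟩

theorem up_mono {S T : Set Pt} (h : S ⊆ T) : Up S ⊆ Up T :=
  up_subset_up (h.trans (subset_up T))

theorem down_mono {S T : Set Pt} (h : S ⊆ T) : Down S ⊆ Down T := by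
  rintro q ⟨z, hz, h1, h2⟩
  exact ⟨z, convexHull_mono h hz, h1, h2⟩

open Pointwise in
-- The reflection through the origin swaps above and below, reverses the lexicographic order and
-- preserves orientation; it transfers every result on lower chains to upper chains.
theorem mem_down_of_neg_mem_up {S : Set Pt} {q : Pt} (h : -q ∈ Up (-S)) : q ∈ Down S := by
  obtain ⟨z, hz, h1, h2⟩ := h
  rw [convexHull_neg] at hz
  simp only [Prod.fst_neg, Prod.snd_neg] at h1 h2
  exact ⟨-z, hz, by simp only [Prod.fst_neg]; linarith, by simp only [Prod.snd_neg]; linarith⟩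

/-- The point lies on the vertical segment between a hull point below it and a hull point above it.
-/
theorem mem_convexHull_of_mem_up_of_mem_down {S : Set Pt} {q : Pt} (hu : q ∈ Up S)
    (hd : q ∈ Down S) : q ∈ convexHull ℝ S := by
  obtain ⟨z, hz, z1, z2⟩ := hu
  obtain ⟨w, hw, w1, w2⟩ := hd
  rcases eq_or_lt_of_le (z2.trans w2) with h | h
  · rwa [show q = z from Prod.ext z1.symm (by linarith)]
  · have hd : 0 < w.2 - z.2 := sub_pos.2 h
    refine (convex_convexHull ℝ S).segment_subset hz hw
      ⟨(w.2 - q.2) / (w.2 - z.2), (q.2 - z.2) / (w.2 - z.2), ?_, ?_, ?_, ?_⟩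
    · exact div_nonneg (by linarith) hd.le
    · exact div_nonneg (by linarith) hd.le
    · field_simp; ring
    · ext
      · simp only [Prod.fst_add, Prod.smul_fst, smul_eq_mul, z1, w1]
        field_simp; ring
      · simp only [Prod.snd_add, Prod.smul_snd, smul_eq_mul]
        field_simp; ring

theorem mem_up_of_fst_eq {S : Set Pt} {a q : Pt} (ha : a ∈ S) (h : a.1 = q.1) (h' : a.2 ≤ q.2) :
    q ∈ Up S := ⟨a, subset_convexHull ℝ S ha, h, h'⟩

theorem mem_up_of_cross_nonneg {S : Set Pt} {a b q : Pt} (ha : a ∈ S) (hb : b ∈ S)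
    (hab : a.1 < b.1) (haq : a.1 ≤ q.1) (hqb : q.1 ≤ b.1) (h : 0 ≤ cross a b q) : q ∈ Up S := by
  have hd : 0 < b.1 - a.1 := sub_pos.2 hab
  refine ⟨((b.1 - q.1) / (b.1 - a.1)) • a + ((q.1 - a.1) / (b.1 - a.1)) • b, ?_, ?_, ?_⟩
  · refine convex_convexHull ℝ S (subset_convexHull ℝ S ha) (subset_convexHull ℝ S hb) ?_ ?_ ?_
    · exact div_nonneg (by linarith) hd.le
    · exact div_nonneg (by linarith) hd.le
    · field_simp; ring
  · simp only [Prod.fst_add, Prod.smul_fst, smul_eq_mul]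
    field_simp; ring
  · simp only [Prod.snd_add, Prod.smul_snd, smul_eq_mul]
    rw [div_mul_eq_mul_div, div_mul_eq_mul_div, ← add_div, div_le_iff₀ hd]
    unfold cross at h
    nlinarith

/-- The lexicographic bounds cover vertical edges, where the determinant carries no information
about height: there `a` itself lies below `q`. -/
theorem mem_up_of_lexLe {S : Set Pt} {a b q : Pt} (ha : a ∈ S) (hb : b ∈ S) (haq : LexLe a q)
    (hqb : LexLe q b) (h : 0 ≤ cross a b q) : q ∈ Up S := by
  rcases haq with h1 | ⟨h1, h2⟩
  · exact mem_up_of_cross_nonneg ha hb (h1.trans_le hqb.fst_le) h1.le hqb.fst_le h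
  · exact mem_up_of_fst_eq ha h1 h2

open Pointwise in
theorem mem_down_of_lexLe {S : Set Pt} {a b q : Pt} (ha : a ∈ S) (hb : b ∈ S) (haq : LexLe a q)
    (hqb : LexLe q b) (h : cross a b q ≤ 0) : q ∈ Down S := by
  refine mem_down_of_neg_mem_up (mem_up_of_lexLe (a := -b) (b := -a) (by simpa) (by simpa)
    hqb.neg haq.neg ?_)
  rw [cross_neg, cross_rotate, cross_swap]
  linarith

theorem mem_down_of_fst_eq {S : Set Pt} {a q : Pt} (ha : a ∈ S) (h : a.1 = q.1)
    (h' : q.2 ≤ a.2) : q ∈ Down S := ⟨a, subset_convexHull ℝ S ha, h, h'⟩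

theorem mem_down_of_cross_nonpos {S : Set Pt} {a b q : Pt} (ha : a ∈ S) (hb : b ∈ S)
    (hab : a.1 < b.1) (haq : a.1 ≤ q.1) (hqb : q.1 ≤ b.1) (h : cross a b q ≤ 0) :
    q ∈ Down S := by
  refine mem_down_of_neg_mem_up (mem_up_of_cross_nonneg (a := -b) (b := -a) (by simpa) (by simpa)
    (by simpa) (by simpa) (by simpa) ?_)
  rw [cross_neg, cross_rotate, cross_swap]
  linarith

theorem cross_convexComb (a b x y : Pt) {s t : ℝ} (h : s + t = 1) :
    cross a b (s • x + t • y) = s * cross a b x + t * cross a b y := by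
  simp only [cross, Prod.fst_add, Prod.snd_add, Prod.smul_fst, Prod.smul_snd, smul_eq_mul]
  linear_combination (a.2 * b.1 - a.1 * b.2) * h

theorem convex_cross_nonneg (a b : Pt) : Convex ℝ {q | 0 ≤ cross a b q} := by
  intro x hx y hy s t hs ht hst
  simp only [Set.mem_ofPred_eq] at *
  rw [cross_convexComb a b x y hst]
  positivity

theorem cross_nonneg_of_mem_up {S : Set Pt} {a b q : Pt} (hab : a.1 ≤ b.1)
    (h : ∀ x ∈ S, 0 ≤ cross a b x) (hq : q ∈ Up S) : 0 ≤ cross a b q := by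
  obtain ⟨z, hz, h1, h2⟩ := hq
  have : 0 ≤ cross a b z := convexHull_min h (convex_cross_nonneg a b) hz
  unfold cross at *
  rw [← h1]
  nlinarith

/-- This places the whole hull after its lexicographically first point, so a query before that point
can be rejected. -/
theorem convex_lexLe_left (a : Pt) : Convex ℝ {q | LexLe a q} := by
  intro x hx y hy s t hs ht hst
  simp only [Set.mem_ofPred_eq, LexLe, Prod.fst_add, Prod.snd_add, Prod.smul_fst, Prod.smul_snd,
    smul_eq_mul] at *
  have e1 : a.1 = s * a.1 + t * a.1 := by rw [← add_mul, hst, one_mul]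
  have e2 : a.2 = s * a.2 + t * a.2 := by rw [← add_mul, hst, one_mul]
  rcases hs.eq_or_lt with rfl | hs
  · obtain rfl : t = 1 := by linarith
    simpa using hy
  rcases ht.eq_or_lt with rfl | ht
  · obtain rfl : s = 1 := by linarith
    simpa using hx
  rcases hx with hx | ⟨hx, hx'⟩ <;> rcases hy with hy | ⟨hy, hy'⟩
  · left; rw [e1]; gcongr
  · left; rw [e1, ← hy]; gcongr
  · left; rw [e1, ← hx]; gcongr
  · right
    rw [← hx, ← hy]
    refine ⟨e1, ?_⟩
    rw [e2]; gcongr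

theorem convex_lexLe_right (b : Pt) : Convex ℝ {q | LexLe q b} := by
  intro x hx y hy s t hs ht hst
  have := convex_lexLe_left (-b) (x := -x) (LexLe.neg hx) (y := -y) (LexLe.neg hy) hs ht hst
  simpa [add_comm] using LexLe.neg this

/-! ## The monotone chain method -/

/-- A list in decreasing lexicographic order that, read backwards, makes only strict left turns. -/
structure LeftChain (s : List Pt) : Prop where
  sorted : s.Pairwise fun a b => LexLe b a
  turn : s.Triplewise fun c b a => 0 < cross a b c

/-- The turns force `a.1 < b.1 < c.1`, so only the last edge can be vertical. Slopes increase along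
the path, hence the direction from `c` to `d` is to the left of that from `a` to `b`; both
conclusions follow by adding determinants. -/
theorem cross_pos_trans {a b c d : Pt} (hab : LexLe a b) (hbc : LexLe b c) (hcd : LexLe c d)
    (h : 0 < cross a b c) (h' : 0 < cross b c d) : 0 < cross a b d ∧ 0 < cross a c d := by
  have hbc1 : b.1 < c.1 := by
    rcases hbc with h1 | ⟨h1, h2⟩
    · exact h1
    · have := hcd.fst_le
      unfold cross at h'
      rw [h1, sub_self, zero_mul] at h'
      nlinarith
  have hab1 : a.1 < b.1 := by
    rcases hab with h1 | ⟨h1, h2⟩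
    · exact h1
    · unfold cross at h
      rw [h1, sub_self, zero_mul] at h
      nlinarith
  have hcd1 := hcd.fst_le
  -- With edge vectors `u`, `v`, `w` this is `v.1 * det(u, w) = w.1 * det(u, v) + u.1 * det(v, w)`.
  have key : (c.1 - b.1) * ((b.1 - a.1) * (d.2 - c.2) - (b.2 - a.2) * (d.1 - c.1)) =
      (d.1 - c.1) * cross a b c + (b.1 - a.1) * cross b c d := by
    unfold cross; ring
  have hpos : 0 < (b.1 - a.1) * (d.2 - c.2) - (b.2 - a.2) * (d.1 - c.1) := by
    refine pos_of_mul_pos_right (a := c.1 - b.1) ?_ (by linarith)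
    rw [key]
    have : 0 < (b.1 - a.1) * cross b c d := mul_pos (by linarith) h'
    have : 0 ≤ (d.1 - c.1) * cross a b c := mul_nonneg (by linarith) h.le
    linarith
  have e1 : cross a b d = cross a b c +
      ((b.1 - a.1) * (d.2 - c.2) - (b.2 - a.2) * (d.1 - c.1)) := by unfold cross; ring
  have e2 : cross a c d = cross b c d +
      ((b.1 - a.1) * (d.2 - c.2) - (b.2 - a.2) * (d.1 - c.1)) := by unfold cross; ring
  constructor <;> linarith

/-- A local test implies the global property: the left turn at the top edge propagates down the
stack by `cross_pos_trans`. This is why the algorithm inspects only the two topmost points. -/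
theorem LeftChain.cons {p a b : Pt} {s : List Pt} (h : LeftChain (b :: a :: s))
    (hp : LexLe b p) (hc : 0 < cross a b p) : LeftChain (p :: b :: a :: s) := by
  obtain ⟨h1, h2⟩ := h
  simp only [List.pairwise_cons, List.mem_cons, List.triplewise_cons] at h1 h2
  obtain ⟨hb, ha, hs⟩ := h1
  obtain ⟨⟨tba, tb⟩, ta, ts⟩ := h2
  have hab := hb a (Or.inl rfl)
  have hza : ∀ z ∈ s, 0 < cross z a p ∧ 0 < cross z b p := fun z hz =>
    cross_pos_trans (ha z hz) hab hp (tba z hz) hc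
  have hpx : ∀ x, x = b ∨ x = a ∨ x ∈ s → LexLe x p := by
    rintro x (rfl | rfl | hx)
    · exact hp
    · exact hab.trans hp
    · exact ((ha x hx).trans hab).trans hp
  refine ⟨?_, ?_⟩
  · simp only [List.pairwise_cons, List.mem_cons]
    exact ⟨hpx, hb, ha, hs⟩
  · simp only [List.triplewise_cons, List.pairwise_cons, List.mem_cons]
    refine ⟨⟨?_, ?_, ?_⟩, ⟨tba, tb⟩, ta, ts⟩
    · rintro z (rfl | hz)
      · exact hc
      · exact (hza z hz).2
    · exact fun z hz => (hza z hz).1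
    · refine (ta.and hs).imp_of_mem fun {y z} hy hz hyz => ?_
      exact (cross_pos_trans hyz.2 (ha y hy) (hab.trans hp) hyz.1 (hza y hy).1).1

theorem LeftChain.of_cons {a : Pt} {s : List Pt} (h : LeftChain (a :: s)) : LeftChain s :=
  ⟨(List.pairwise_cons.1 h.1).2, (List.triplewise_cons.1 h.2).2⟩

/-- All vertices of a chain lie on or to the left of each of its edges. -/
theorem LeftChain.cross_nonneg {s : List Pt} (h : LeftChain s) {u v : List Pt} {a b : Pt}
    (e : s = u ++ b :: a :: v) {x : Pt} (hx : x ∈ s) : 0 ≤ cross a b x := by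
  have ht := h.turn
  rw [e, List.triplewise_append] at ht
  simp only [List.triplewise_cons, List.pairwise_cons, List.mem_cons] at ht
  obtain ⟨-, ⟨⟨t1, -⟩, -⟩, t2, -⟩ := ht
  rw [e, List.mem_append, List.mem_cons, List.mem_cons] at hx
  rcases hx with hx | rfl | rfl | hx
  · exact ((t2 x hx).1 a (Or.inl rfl)).le
  · simp [cross, mul_comm]
  · simp [cross]
  · rw [← cross_rotate]
    exact (t1 x hx).le

namespace Timed

/-- A popped point lies above the segment from its predecessor to `p`, so the region above the stack
loses nothing. The bottom of the stack is never popped and remains the first point of the chain. -/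
theorem popStack_spec (p : Pt) (s : List Pt) (hs : LeftChain s) (hp : ∀ x ∈ s, LexLe x p) :
    LeftChain (p :: (popStack p s).val) ∧ (popStack p s).val <:+ s ∧
      (popStack p s).val.getLast? = s.getLast? ∧
      ∀ q ∈ s, q ∈ Up {x | x ∈ p :: (popStack p s).val} := by
  fun_induction popStack p s with
  | case1 => exact ⟨⟨by simp, by simp⟩, List.suffix_refl _, rfl, by simp⟩
  | case2 a =>
    refine ⟨⟨?_, List.triplewise_pair _ _ _⟩, List.suffix_refl _, rfl, fun q hq => subset_up _ ?_⟩
    · exact List.pairwise_pair.2 (hp a (by simp))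
    · exact List.mem_cons_of_mem _ hq
  | case3 b a s ih =>
    simp only [val_bind, val_ite, val_pure, val_cross, val_le, decide_eq_true_eq]
    split_ifs with hc
    · obtain ⟨h1, h2, h3, h4⟩ := ih hs.of_cons fun x hx => hp x (List.mem_cons_of_mem _ hx)
      refine ⟨h1, h2.trans (List.suffix_cons _ _), by rw [h3, List.getLast?_cons_cons], ?_⟩
      intro q hq
      rcases List.mem_cons.1 hq with rfl | hq
      · have hpm : p ∈ Up {x | x ∈ p :: (popStack p (a :: s)).val} := subset_up _ (by simp)
        have ham := h4 a (by simp)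
        refine up_subset_up (S := {a, p}) ?_ ?_
        · rintro x (rfl | rfl)
          · exact ham
          · exact hpm
        · refine mem_up_of_lexLe (a := a) (b := p) (by simp) (by simp) ?_ (hp q (by simp)) ?_
          · exact (List.pairwise_cons.1 hs.sorted).1 a (by simp)
          · rw [cross_swap]; linarith
      · exact h4 q hq
    · push Not at hc
      refine ⟨hs.cons (hp b (by simp)) hc, List.suffix_refl _, rfl, fun q hq => subset_up _ ?_⟩
      exact List.mem_cons_of_mem _ hq

/-- Amortization with ten units of potential per stack cell: one pop costs a call, a determinant and
a comparison, `1 + 8 + 1`. The additive `10` pays for the final test. -/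
theorem popStack_steps (p : Pt) (s : List Pt) :
    (popStack p s).steps + 10 * (popStack p s).val.length ≤ 10 * s.length + 10 := by
  fun_induction popStack p s with
  | case1 => simp
  | case2 a => simp
  | case3 b a s ih =>
    simp only [steps_bind, steps_ite, steps_pure, steps_tick, steps_cross, steps_le, val_bind,
      val_ite, val_pure, val_cross, val_le, decide_eq_true_eq]
    simp only [List.length_cons] at *
    split_ifs
    · omega
    · simp only [List.length_cons]
      omega

theorem scan_spec (s l : List Pt) (hs : LeftChain s) (hl : l.Pairwise LexLe)
    (hsl : ∀ x ∈ s, ∀ y ∈ l, LexLe x y) :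
    LeftChain (scan s l).val ∧ (∀ x ∈ (scan s l).val, x ∈ s ∨ x ∈ l) ∧
      (∀ q, q ∈ s ∨ q ∈ l → q ∈ Up {x | x ∈ (scan s l).val}) ∧
      (scan s l).val.head? = (s.reverse ++ l).getLast? ∧
      (scan s l).val.getLast? = (s.reverse ++ l).head? := by
  induction l generalizing s with
  | nil =>
    refine ⟨hs, by simp [scan], fun q hq => subset_up _ (by simpa [scan] using hq), ?_, ?_⟩ <;>
    simp [scan]
  | cons p l ih =>
    simp only [scan, val_bind]
    rw [List.pairwise_cons] at hl
    obtain ⟨h1, h2, h3, h4⟩ := popStack_spec p s hs fun x hx => hsl x hx p (by simp)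
    obtain ⟨i1, i2, i3, i4, i5⟩ := ih _ h1 hl.2 (by
      intro x hx y hy
      rcases List.mem_cons.1 hx with rfl | hx
      · exact hl.1 y hy
      · exact hsl x (h2.mem hx) y (by simp [hy]))
    refine ⟨i1, ?_, ?_, ?_, ?_⟩
    · intro x hx
      rcases i2 x hx with hx | hx
      · rcases List.mem_cons.1 hx with rfl | hx
        · simp
        · exact Or.inl (h2.mem hx)
      · simp [hx]
    · rintro q (hq | hq)
      · refine up_subset_up ?_ (h4 q hq)
        exact fun x hx => i3 x (Or.inl hx)
      · rcases List.mem_cons.1 hq with rfl | hq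
        · exact i3 q (by simp)
        · exact i3 q (Or.inr hq)
    · rw [i4]
      simp only [List.reverse_cons, List.append_assoc, List.singleton_append,
        List.getLast?_append_cons]
    · rw [i5]
      simp only [List.reverse_cons, List.append_assoc, List.singleton_append,
        List.head?_append, List.head?_reverse, h3]

theorem scan_steps (s l : List Pt) : (scan s l).steps ≤ 10 * s.length + 21 * l.length + 1 := by
  induction l generalizing s with
  | nil => simp [scan]
  | cons p l ih =>
    simp only [scan, steps_bind, steps_tick, List.length_cons]
    -- The `21` per input point is one step for the call, `10` for the final test and `10` for the
    -- potential of the pushed cell.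
    have h1 := popStack_steps p s
    have h2 := ih (p :: (popStack p s).val)
    simp only [List.length_cons] at h2
    omega

theorem popStack_length_le (p : Pt) (s : List Pt) : (popStack p s).val.length ≤ s.length := by
  fun_induction popStack p s with
  | case1 => simp
  | case2 a => simp
  | case3 b a s ih =>
    simp only [val_bind, val_ite, val_pure]
    split_ifs
    · exact ih.trans (by simp)
    · simp

theorem scan_length_le (s l : List Pt) : (scan s l).val.length ≤ s.length + l.length := by
  induction l generalizing s with
  | nil => simp [scan]
  | cons p l ih =>
    simp only [scan, val_bind, List.length_cons]
    have h1 := popStack_length_le p s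
    have h2 := ih (p :: (popStack p s).val)
    simp only [List.length_cons] at h2
    omega

theorem popStack_ne_nil (p : Pt) (s : List Pt) (hs : s ≠ []) : (popStack p s).val ≠ [] := by
  fun_induction popStack p s with
  | case1 => exact absurd rfl hs
  | case2 a => simp
  | case3 b a s ih =>
    simp only [val_bind, val_ite, val_pure]
    split_ifs
    · exact ih (by simp)
    · simp

/-- Even for coinciding points the chain keeps two entries, so binary search always has an edge to
return. -/
theorem two_le_length_scan (s l : List Pt) (h : 2 ≤ s.length + l.length) :
    2 ≤ (scan s l).val.length := by
  induction l generalizing s with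
  | nil => simpa [scan] using h
  | cons p l ih =>
    simp only [scan, val_bind]
    apply ih
    rcases s.eq_nil_or_concat with rfl | ⟨s', a, rfl⟩
    · simp only [List.length_nil, List.length_cons] at h ⊢
      omega
    · have := List.length_pos_iff.2 (popStack_ne_nil p (s' ++ [a]) (by simp))
      simp only [List.length_cons, List.concat_eq_append]
      omega

theorem popStack_map_neg (p : Pt) (s : List Pt) :
    (popStack (-p) (s.map Neg.neg)).val = (popStack p s).val.map Neg.neg := by
  fun_induction popStack p s with
  | case1 => simp [popStack]
  | case2 a => simp [popStack]
  | case3 b a s ih =>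
    rw [List.map_cons] at ih
    simp only [List.map_cons, popStack, val_bind, val_ite, val_pure, val_cross, cross_neg,
      val_le, decide_eq_true_eq]
    split_ifs
    · exact ih
    · simp

/-- The upper chain is a scan of the reversed list; after reflection it becomes the lower chain of
the negated points. -/
theorem scan_map_neg (s l : List Pt) :
    (scan (s.map Neg.neg) (l.map Neg.neg)).val = (scan s l).val.map Neg.neg := by
  induction l generalizing s with
  | nil => simp [scan]
  | cons p l ih =>
    simp only [List.map_cons, scan, val_bind, popStack_map_neg]
    rw [← List.map_cons, ih]

end Timed

/-! ## Vertices of a convex polygon -/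

/-- Krein–Milman; the closure is superfluous because the hull of finitely many extreme points is
compact. -/
theorem convexHull_extremePoints_of_finite {S : Set Pt} (hS : S.Finite) :
    convexHull ℝ ((convexHull ℝ S).extremePoints ℝ) = convexHull ℝ S := by
  have hfin : ((convexHull ℝ S).extremePoints ℝ).Finite :=
    hS.subset extremePoints_convexHull_subset
  rw [← (hfin.isCompact_convexHull ℝ).isClosed.closure_eq]
  exact closure_convexHull_extremePoints (hS.isCompact_convexHull ℝ) (convex_convexHull ℝ S)

theorem mem_extremePoints_convexHull_of_finite {S : Set Pt} (hS : S.Finite) {p : Pt} (hp : p ∈ S)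
    (h : p ∉ convexHull ℝ (S \ {p})) : p ∈ (convexHull ℝ S).extremePoints ℝ := by
  by_contra hc
  refine h (convexHull_mono ?_ ((convexHull_extremePoints_of_finite hS).symm ▸
    subset_convexHull ℝ S hp))
  exact fun x hx => ⟨extremePoints_convexHull_subset hx, fun hxp => hc (hxp ▸ hx)⟩

theorem finite_setOf_mem (l : List Pt) : {p | p ∈ l}.Finite := List.finite_toSet l

/-- An open half plane together with the single point `u` of its boundary line is convex, and it
misses `p`, which is on that line too. -/
theorem notMem_convexHull_of_cross_pos {S : Set Pt} {p u : Pt} (hpu : u ≠ p)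
    (h : ∀ x ∈ S, x ≠ u → 0 < cross p u x) : p ∉ convexHull ℝ S := by
  have hconv : Convex ℝ {x | x = u ∨ 0 < cross p u x} := by
    have huu : cross p u u = 0 := by unfold cross; ring
    intro x hx y hy s t hs ht hst
    simp only [Set.mem_ofPred_eq] at *
    rw [cross_convexComb p u x y hst]
    rcases hs.eq_or_lt with rfl | hs
    · obtain rfl : t = 1 := by linarith
      simpa using hy
    rcases ht.eq_or_lt with rfl | ht
    · obtain rfl : s = 1 := by linarith
      simpa using hx
    rcases hx with rfl | hx <;> rcases hy with rfl | hy
    · left; rw [← add_smul, hst, one_smul]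
    · right; rw [huu]; simp [hy, ht]
    · right; rw [huu]; simp [hx, hs]
    · right; positivity
  intro hp
  have := convexHull_min (t := {x | x = u ∨ 0 < cross p u x})
    (fun x hx => or_iff_not_imp_left.2 (h x hx)) hconv hp
  rcases this with h' | h'
  · exact hpu h'.symm
  · simp [cross] at h'

/-- The line from `p` to its cyclic successor `u` has all other listed points strictly on its left,
so `p` is not in the hull of the others. -/
theorem represents_of_ccw {Q : List Pt} (hn : Q.Nodup)
    (hccw : Q.Triplewise fun a b c => 0 < cross a b c) :
    Represents Q (convexHull ℝ {p | p ∈ Q}) := by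
  refine ⟨rfl, fun p => ⟨fun hp => ?_, fun hp =>
    extremePoints_convexHull_subset (A := {p | p ∈ Q}) hp⟩, hn, hccw⟩
  refine mem_extremePoints_convexHull_of_finite (finite_setOf_mem Q) hp ?_
  obtain ⟨X, Y, rfl⟩ := List.mem_iff_append.1 hp
  rw [List.triplewise_append, List.triplewise_cons] at hccw
  obtain ⟨-, ⟨hY, -⟩, hX, hX'⟩ := hccw
  simp only [List.pairwise_cons] at hX
  have hne : ∀ x, x ∈ X ∨ x ∈ Y → x ≠ p := by
    rintro x hx rfl
    rw [List.nodup_append] at hn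
    rcases hx with hx | hx
    · exact hn.2.2 x hx x (by simp) rfl
    · exact (List.nodup_cons.1 hn.2.1).1 hx
  cases Y with
  | cons u Y =>
    refine notMem_convexHull_of_cross_pos (u := u) (hne u (by simp)) ?_
    rintro x ⟨hx, hxp⟩ hxu
    simp only [Set.mem_ofPred_eq, List.mem_append, List.mem_cons] at hx
    rcases hx with hx | rfl | rfl | hx
    · rw [← cross_rotate]
      exact (hX x hx).1 u (by simp)
    · exact absurd rfl hxp
    · exact absurd rfl hxu
    · exact (List.pairwise_cons.1 hY).1 x hx
  -- Here `p` is the last entry, and its cyclic successor is the head of the list.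
  | nil =>
    cases X with
    | nil => simp
    | cons u X =>
      refine notMem_convexHull_of_cross_pos (u := u) (hne u (by simp)) ?_
      rintro x ⟨hx, hxp⟩ hxu
      simp only [Set.mem_ofPred_eq, List.mem_append, List.mem_cons] at hx
      rcases hx with (rfl | hx) | rfl | hx
      · exact absurd rfl hxu
      · rw [cross_rotate]
        exact (List.pairwise_cons.1 (hX' p (by simp))).1 x hx
      · exact absurd rfl hxp
      · simp at hx

theorem nodup_of_ccw {Q : List Pt} (hccw : Q.Triplewise fun a b c => 0 < cross a b c)
    (hl : 3 ≤ Q.length) : Q.Nodup := by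
  rw [List.triplewise_iff_getElem] at hccw
  rw [List.Nodup, List.pairwise_iff_getElem]
  intro i j hi hj hij e
  by_cases h1 : j + 1 < Q.length
  · have := hccw i j (j + 1) hij (by omega) h1
    simp [cross, e] at this
  by_cases h2 : 0 < i
  · have := hccw 0 i j h2 hij hj
    rw [e] at this
    simp [cross, mul_comm] at this
  · have := hccw i (i + 1) j (by omega) (by omega) hj
    rw [e] at this
    simp [cross] at this

/-! ## The two chains of a convex hull -/

/-- `lower` and `upper` are the two monotone chains of the convex hull of `l`, whose
lexicographically first and last points are `a` and `z`. -/
structure HullChains (l lower upper : List Pt) (a z : Pt) : Prop where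
  lower_chain : LeftChain lower
  upper_chain : LeftChain (upper.map Neg.neg)
  lower_sub : ∀ x ∈ lower, x ∈ l
  upper_sub : ∀ x ∈ upper, x ∈ l
  mem_up : ∀ q ∈ l, q ∈ Up {x | x ∈ lower}
  neg_mem_up : ∀ q ∈ l, -q ∈ Up {x | x ∈ upper.map Neg.neg}
  lower_head : lower.head? = some z
  lower_last : lower.getLast? = some a
  upper_head : upper.head? = some a
  upper_last : upper.getLast? = some z
  first_le : ∀ q ∈ l, LexLe a q
  le_last : ∀ q ∈ l, LexLe q z

open Pointwise in
theorem setOf_mem_map_neg (l : List Pt) : {x | x ∈ l.map Neg.neg} = -{x | x ∈ l} := by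
  ext x
  simp only [Set.mem_ofPred_eq, List.mem_map, Set.mem_neg]
  constructor
  · rintro ⟨y, hy, rfl⟩
    simpa using hy
  · exact fun h => ⟨-x, h, neg_neg x⟩

namespace HullChains

variable {l lower upper : List Pt} {a z : Pt}

theorem mem_down (h : HullChains l lower upper a z) {q : Pt} (hq : q ∈ l) :
    q ∈ Down {x | x ∈ upper} :=
  mem_down_of_neg_mem_up (setOf_mem_map_neg upper ▸ h.neg_mem_up q hq)

theorem convexHull_eq (h : HullChains l lower upper a z) :
    convexHull ℝ {x | x ∈ lower ∨ x ∈ upper} = convexHull ℝ {x | x ∈ l} := by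
  apply subset_antisymm
  · refine convexHull_mono fun x hx => ?_
    rcases hx with hx | hx
    · exact h.lower_sub x hx
    · exact h.upper_sub x hx
  · refine convexHull_min (fun q hq => ?_) (convex_convexHull ℝ _)
    exact mem_convexHull_of_mem_up_of_mem_down (up_mono (fun x hx => Or.inl hx) (h.mem_up q hq))
      (down_mono (fun x hx => Or.inr hx) (h.mem_down hq))

end HullChains

/-- Every vertex of the upper chain lies to the left of every chord of the lower chain. -/
theorem LeftChain.pairwise_cross_pos {s t : List Pt} {a z : Pt} (hs : LeftChain (z :: s))
    (ht : LeftChain ((a :: t).map Neg.neg)) (hsa : s.getLast? = some a)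
    (htz : t.getLast? = some z) {x : Pt} (hx : x ∈ t) :
    s.Pairwise fun c b => 0 < cross b c x := by
  have hz := (List.triplewise_cons.1 hs.turn).1
  obtain ⟨w, rfl⟩ := List.getLast?_eq_some_iff.1 hsa
  obtain ⟨v, rfl⟩ := List.getLast?_eq_some_iff.1 htz
  rw [List.mem_append, List.mem_singleton] at hx
  rcases hx with hx | rfl
  swap
  · exact hz
  have hax : a.1 ≤ x.1 := by
    have := (List.pairwise_cons.1 ht.sorted).1 (-x) (by simp [hx])
    simpa using this.neg.fst_le
  have hxz : x.1 ≤ z.1 := by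
    have := List.pairwise_map.1 (List.pairwise_cons.1 ht.sorted).2
    exact ((List.pairwise_append.1 this).2.2 x hx z (by simp)).neg.fst_le.trans_eq' (by simp)
      |>.trans_eq (by simp)
  have hazx : 0 < cross a z x := by
    have := List.pairwise_map.1 (List.triplewise_cons.1 ht.turn).1
    have := (List.pairwise_append.1 this).2.2 x hx z (by simp)
    rwa [cross_neg, ← cross_rotate] at this
  have hsorted := (List.pairwise_cons.1 hs.sorted)
  have ha : (w ++ [a]).Pairwise fun c b => 0 ≤ cross b c a := by
    have h1 := (List.triplewise_cons.1 hs.turn).2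
    rw [List.triplewise_append] at h1
    refine List.pairwise_append.2 ⟨(h1.2.2.2 a (by simp)).imp ?_, by simp, ?_⟩
    · intro c b h
      rw [← cross_rotate]
      exact h.le
    · intro c _ b hb
      rw [List.mem_singleton.1 hb]
      simp [cross]
  refine ((hz.and ha).and hsorted.2).imp_of_mem ?_
  rintro c b hc hb ⟨⟨h1, h2⟩, h3⟩
  have hcz := (hsorted.1 c hc).fst_le
  have hab : a.1 ≤ b.1 := by
    rw [List.mem_append, List.mem_singleton] at hb
    rcases hb with hb | rfl
    · exact ((List.pairwise_append.1 hsorted.2).2.2 b hb a (by simp)).fst_le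
    · exact le_rfl
  have hbc : b.1 < c.1 := by
    rcases h3 with h3 | ⟨h3, h4⟩
    · exact h3
    · unfold cross at h1
      rw [h3, sub_self, zero_mul] at h1
      nlinarith
  -- The point `x` is compared with the point of the chord `a z` on the same vertical line: the
  -- first two terms interpolate between `a` and `z`, the third measures how far `x` is above the
  -- chord.
  have key : (z.1 - a.1) * cross b c x =
      (z.1 - x.1) * cross b c a + (x.1 - a.1) * cross b c z + (c.1 - b.1) * cross a z x := by
    unfold cross; ring
  refine pos_of_mul_pos_right (a := z.1 - a.1) ?_ (by linarith)
  rw [key]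
  have e1 : 0 ≤ (z.1 - x.1) * cross b c a := mul_nonneg (by linarith) h2
  have e2 : 0 ≤ (x.1 - a.1) * cross b c z := mul_nonneg (by linarith) h1.le
  have e3 : 0 < (c.1 - b.1) * cross a z x := mul_pos (by linarith) hazx
  linarith

/-- Each chain gives up its head, so `a` and `z` occur once each. Mixed triples, two points from one
chain and one from the other, turn left by `LeftChain.pairwise_cross_pos`, applied directly or to
the reflected chains. -/
theorem HullChains.represents {l s t : List Pt} {a z : Pt} (h : HullChains l (z :: s) (a :: t) a z)
    (haz : a ≠ z) : Represents (s.reverse ++ t.reverse) (convexHull ℝ {p | p ∈ l}) := by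
  have hsa : s.getLast? = some a := by
    have := h.lower_last
    cases s with
    | nil => exact absurd (by simpa using this.symm) haz
    | cons b s => rwa [List.getLast?_cons_cons] at this
  have htz : t.getLast? = some z := by
    have := h.upper_last
    cases t with
    | nil => exact absurd (by simpa using this) haz
    | cons b s => rwa [List.getLast?_cons_cons] at this
  have hccw : (s.reverse ++ t.reverse).Triplewise fun a b c => 0 < cross a b c := by
    have h1 := (List.triplewise_cons.1 h.lower_chain.turn).2
    have h2 := List.triplewise_map.1 (List.triplewise_cons.1 h.upper_chain.turn).2
    simp only [cross_neg] at h2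
    refine List.triplewise_append.2 ⟨List.triplewise_reverse.2 h1, List.triplewise_reverse.2 h2,
      ?_, ?_⟩
    · intro x hx
      rw [List.pairwise_reverse]
      have := LeftChain.pairwise_cross_pos (s := t.map Neg.neg) (t := s.map Neg.neg)
        (a := -z) (z := -a) (x := -x) h.upper_chain
        (by simpa [Function.comp_def] using h.lower_chain) (by simp [htz]) (by simp [hsa])
        (by simpa using hx)
      rw [List.pairwise_map] at this
      refine this.imp fun {c b} hcb => ?_
      rwa [cross_neg, ← cross_rotate] at hcb
    · intro x hx
      rw [List.pairwise_reverse]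
      exact LeftChain.pairwise_cross_pos h.lower_chain h.upper_chain hsa htz (List.mem_reverse.1 hx)
  have hmem : {p | p ∈ s.reverse ++ t.reverse} = {x | x ∈ z :: s ∨ x ∈ a :: t} := by
    have ha := List.mem_of_getLast? hsa
    have hz := List.mem_of_getLast? htz
    ext x
    simp only [Set.mem_ofPred_eq, List.mem_append, List.mem_reverse, List.mem_cons]
    constructor
    · tauto
    · rintro ((rfl | hx) | (rfl | hx)) <;> tauto
  have hn : (s.reverse ++ t.reverse).Nodup := by
    obtain ⟨w, rfl⟩ := List.getLast?_eq_some_iff.1 hsa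
    obtain ⟨v, rfl⟩ := List.getLast?_eq_some_iff.1 htz
    -- If the polygon is the segment from `a` to `z`, there is no triple to exclude repetitions, and
    -- `a ≠ z` is used instead.
    by_cases hl : w = [] ∧ v = []
    · obtain ⟨rfl, rfl⟩ := hl
      simpa using haz
    · refine nodup_of_ccw hccw ?_
      have : 0 < w.length ∨ 0 < v.length := by
        simp only [List.length_pos_iff]
        tauto
      simp only [List.length_append, List.length_reverse, List.length_singleton]
      omega
  rw [← h.convexHull_eq, ← hmem]
  exact represents_of_ccw hn hccw

/-! ### The chains and the polygon that the implementation computes -/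

namespace Timed

theorem chains_val (l : List Pt) : (chains l).val =
    ((scan [] (mergeSort l).val).val, (scan [] (mergeSort l).val.reverse).val) := by
  simp [chains]

theorem leftChain_nil : LeftChain [] := ⟨List.Pairwise.nil, List.Triplewise.nil⟩

theorem chains_spec {l : List Pt} (hl : l ≠ []) :
    ∃ a z, HullChains l (chains l).val.1 (chains l).val.2 a z := by
  rw [chains_val]
  have hperm := mergeSort_perm l
  have hsort := mergeSort_sorted l
  have hne : (mergeSort l).val ≠ [] := fun h => hl (by rw [h] at hperm; exact hperm.symm.eq_nil)
  generalize (mergeSort l).val = s at *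
  obtain ⟨l1, l2, l3, l4, l5⟩ := scan_spec [] s leftChain_nil hsort (by simp)
  obtain ⟨u1, u2, u3, u4, u5⟩ := scan_spec [] (s.reverse.map Neg.neg) leftChain_nil
    (by
      rw [List.pairwise_map, List.pairwise_reverse]
      exact hsort.imp LexLe.neg) (by simp)
  have hneg := scan_map_neg [] s.reverse
  rw [List.map_nil] at hneg
  rw [hneg] at u1 u2 u3 u4 u5
  simp only [List.reverse_nil, List.nil_append, List.not_mem_nil, false_or]
    at l2 l3 l4 l5 u2 u3 u4 u5
  have hinj : Function.Injective (Option.map (Neg.neg : Pt → Pt)) :=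
    Option.map_injective neg_injective
  rw [List.head?_map, List.getLast?_map, hinj.eq_iff, List.getLast?_reverse] at u4
  rw [List.head?_map, List.getLast?_map, hinj.eq_iff, List.head?_reverse] at u5
  refine ⟨s.head hne, s.getLast hne, l1, u1, ?_, ?_, ?_, ?_, ?_, ?_, ?_, ?_, ?_, ?_⟩
  · exact fun x hx => hperm.mem_iff.1 (l2 x hx)
  · intro x hx
    have := u2 (-x) (List.mem_map_of_mem hx)
    simpa [hperm.mem_iff] using this
  · exact fun q hq => l3 q (hperm.mem_iff.2 hq)
  · exact fun q hq => u3 (-q) (by simpa using hperm.mem_iff.2 hq)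
  · rw [l4, List.getLast?_eq_some_getLast hne]
  · rw [l5, List.head?_eq_some_head hne]
  · rw [u4, List.head?_eq_some_head hne]
  · rw [u5, List.getLast?_eq_some_getLast hne]
  · intro q hq
    rw [← hperm.mem_iff] at hq
    cases s with
    | nil => exact absurd rfl hne
    | cons b s =>
      rcases List.mem_cons.1 hq with rfl | hq
      · exact LexLe.refl _
      · exact (List.pairwise_cons.1 hsort).1 q hq
  · intro q hq
    rw [← hperm.mem_iff] at hq
    have e := List.dropLast_append_getLast hne
    rw [← e, List.mem_append, List.mem_singleton] at hq
    rcases hq with hq | hq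
    · rw [← e] at hsort
      exact (List.pairwise_append.1 hsort).2.2 q hq _ (by simp)
    · rw [← hq]
      exact LexLe.refl q

theorem two_le_length_lower {l : List Pt} (hl : 2 ≤ l.length) :
    2 ≤ (chains l).val.1.length := by
  rw [chains_val]
  exact two_le_length_scan _ _ (by simpa [(mergeSort_perm l).length_eq] using hl)

theorem two_le_length_upper {l : List Pt} (hl : 2 ≤ l.length) :
    2 ≤ (chains l).val.2.length := by
  rw [chains_val]
  exact two_le_length_scan _ _ (by simpa [(mergeSort_perm l).length_eq] using hl)

theorem polygon_represents (l : List Pt) (hl : l.Nodup) :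
    Represents (polygon l).val (convexHull ℝ {p | p ∈ l}) := by
  match l, hl with
  | [], _ => exact represents_of_ccw List.nodup_nil List.Triplewise.nil
  | [p], _ => exact represents_of_ccw (List.nodup_singleton p) (List.triplewise_singleton _ _)
  | p :: q :: l, hl =>
    have hv : (polygon (p :: q :: l)).val = (chains (p :: q :: l)).val.1.tail.reverse ++
        (chains (p :: q :: l)).val.2.tail.reverse := by
      simp [polygon]
    rw [hv]
    obtain ⟨a, z, h⟩ := chains_spec (l := p :: q :: l) (by simp)
    generalize (chains (p :: q :: l)).val.1 = lower at *
    generalize (chains (p :: q :: l)).val.2 = upper at *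
    obtain ⟨s, rfl⟩ := List.head?_eq_some_iff.1 h.lower_head
    obtain ⟨t, rfl⟩ := List.head?_eq_some_iff.1 h.upper_head
    refine h.represents ?_
    rintro rfl
    have hp := (h.first_le p (by simp)).antisymm (h.le_last p (by simp))
    have hq := (h.first_le q (by simp)).antisymm (h.le_last q (by simp))
    rw [List.nodup_cons] at hl
    exact hl.1 (by simp [← hp, ← hq])

/-! ## Membership by binary search -/

/-- The invariant that the two end cells bracket `q` already yields two adjacent bracketing cells.
-/
theorem search_spec (A : Array Pt) (q : Pt) (lo hi : ℕ) (h : lo < hi)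
    (hlo : LexLe (A.getD lo (0, 0)) q) (hhi : LexLe q (A.getD hi (0, 0))) :
    (search A q lo hi).val.2 = (search A q lo hi).val.1 + 1 ∧ (search A q lo hi).val.2 ≤ hi ∧
      LexLe (A.getD (search A q lo hi).val.1 (0, 0)) q ∧
      LexLe q (A.getD (search A q lo hi).val.2 (0, 0)) := by
  fun_induction search A q lo hi with
  | case1 lo hi h' =>
    obtain rfl : hi = lo + 1 := by omega
    exact ⟨rfl, le_rfl, hlo, hhi⟩
  | case2 lo hi h' ih₁ ih₂ =>
    simp only [val_bind, val_ite, val_get]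
    split_ifs with hc
    · exact ih₁ (by omega) ((lexLe_val _ _).1 hc) hhi
    · rw [lexLe_val] at hc
      obtain ⟨h1, h2, h3⟩ := ih₂ (by omega) hlo ((LexLe.total _ _).resolve_left hc)
      exact ⟨h1, by omega, h3⟩

theorem search_steps (A : Array Pt) (q : Pt) (lo hi : ℕ) :
    (search A q lo hi).steps ≤ 6 * Nat.clog 2 (hi - lo) + 1 := by
  fun_induction search A q lo hi with
  | case1 lo hi h => simp
  | case2 lo hi h ih₁ ih₂ =>
    simp only [steps_bind, steps_ite, steps_tick, steps_get, val_get]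
    have h1 := lexLe_steps (A.getD ((lo + hi) / 2) (0, 0)) q
    have hc : Nat.clog 2 (hi - lo) = Nat.clog 2 ((hi - lo + 1) / 2) + 1 :=
      Nat.clog_of_two_le one_lt_two (by omega)
    have h2 : Nat.clog 2 (hi - (lo + hi) / 2) ≤ Nat.clog 2 ((hi - lo + 1) / 2) :=
      Nat.clog_mono_right 2 (by omega)
    have h3 : Nat.clog 2 ((lo + hi) / 2 - lo) ≤ Nat.clog 2 ((hi - lo + 1) / 2) :=
      Nat.clog_mono_right 2 (by omega)
    split_ifs <;> omega

theorem getD_toArray (c : List Pt) (i : ℕ) : c.toArray.getD i (0, 0) = c.getD i (0, 0) := by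
  simp

theorem side_spec {c : List Pt} {a z q : Pt} (hc : 2 ≤ c.length) (ha : c.head? = some a)
    (hz : c.getLast? = some z) (haq : LexLe a q) (hqz : LexLe q z) :
    ∃ u v b d, c = u ++ b :: d :: v ∧ LexLe b q ∧ LexLe q d ∧
      (side c.toArray q).val = _root_.cross b d q := by
  obtain ⟨h1, h2, h3, h4⟩ := search_spec c.toArray q 0 (c.length - 1) (by omega)
    (by
      rw [getD_toArray, List.getD_eq_getElem?_getD, ← List.head?_eq_getElem?, ha]
      exact haq)
    (by
      rw [getD_toArray, List.getD_eq_getElem?_getD, ← List.getLast?_eq_getElem?, hz]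
      exact hqz)
  have hv : (side c.toArray q).val = _root_.cross
      (c.toArray.getD (search c.toArray q 0 (c.length - 1)).val.1 (0, 0))
      (c.toArray.getD (search c.toArray q 0 (c.length - 1)).val.2 (0, 0)) q := by
    simp [side]
  rw [hv]
  generalize search c.toArray q 0 (c.length - 1) = r at *
  rw [h1] at *
  generalize r.val.1 = i at *
  rw [getD_toArray] at h3 h4 ⊢
  rw [getD_toArray]
  refine ⟨c.take i, c.drop (i + 2), c.getD i (0, 0), c.getD (i + 1) (0, 0), ?_, h3, h4, rfl⟩
  rw [List.getD_eq_getElem _ _ (by omega), List.getD_eq_getElem _ _ (by omega)]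
  rw [← List.drop_eq_getElem_cons, ← List.drop_eq_getElem_cons, List.take_append_drop]

theorem hullArrays_val (l : List Pt) : (hullArrays l).val =
    ((chains l).val.1.reverse.toArray, (chains l).val.2.toArray) := by
  simp [hullArrays]

/-- The edges found span `q` lexicographically, so the two signs put `q` above the lower and below
the upper chain. Conversely the line through an edge supports its whole chain, so hull points pass
both tests. -/
theorem inHull_hullArrays {l : List Pt} (hl : 2 ≤ l.length) (q : Pt) :
    (inHull (hullArrays l).val q).val = true ↔ q ∈ convexHull ℝ {p | p ∈ l} := by
  obtain ⟨a, z, h⟩ := chains_spec (l := l) (by rintro rfl; simp at hl)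
  have hlow := two_le_length_lower hl
  have hupp := two_le_length_upper hl
  rw [hullArrays_val]
  generalize (chains l).val.1 = lower at *
  generalize (chains l).val.2 = upper at *
  have ha : lower.reverse.toArray.getD 0 (0, 0) = a := by
    rw [getD_toArray, List.getD_eq_getElem?_getD, ← List.head?_eq_getElem?,
      List.head?_reverse, h.lower_last]
    rfl
  have hz : lower.reverse.toArray.getD (lower.reverse.toArray.size - 1) (0, 0) = z := by
    rw [getD_toArray, List.getD_eq_getElem?_getD, List.size_toArray,
      ← List.getLast?_eq_getElem?, List.getLast?_reverse, h.lower_head]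
    rfl
  simp only [inHull, val_bind, val_ite, val_pure, val_get, val_le, ha, hz,
    decide_eq_true_eq]
  by_cases haq : LexLe a q
  swap
  · rw [if_neg (mt (lexLe_val a q).1 haq)]
    simp only [Bool.false_eq_true, false_iff]
    exact fun hq => haq (convexHull_min h.first_le (convex_lexLe_left a) hq)
  by_cases hqz : LexLe q z
  swap
  · rw [if_neg (mt (lexLe_val q z).1 hqz)]
    simp only [ite_self, Bool.false_eq_true, false_iff]
    exact fun hq => hqz (convexHull_min h.le_last (convex_lexLe_right z) hq)
  obtain ⟨u, v, b, d, e, hb, hd, hs⟩ := side_spec (c := lower.reverse) (by simpa using hlow)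
    (by simpa using h.lower_last) (by simpa using h.lower_head) haq hqz
  obtain ⟨u', v', b', d', e', hb', hd', hs'⟩ := side_spec hupp h.upper_head h.upper_last haq hqz
  rw [hs, hs', if_pos ((lexLe_val a q).2 haq), if_pos ((lexLe_val q z).2 hqz)]
  have e2 : lower = v.reverse ++ d :: b :: u.reverse := by
    rw [← List.reverse_reverse lower, e]; simp
  have hcase : (if 0 ≤ _root_.cross b d q then decide (_root_.cross b' d' q ≤ 0) else false) = true
      ↔ 0 ≤ _root_.cross b d q ∧ _root_.cross b' d' q ≤ 0 := by
    split_ifs <;> simp [*]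
  rw [hcase]
  constructor
  · rintro ⟨h1, h2⟩
    refine mem_convexHull_of_mem_up_of_mem_down ?_ ?_
    · exact mem_up_of_lexLe (h.lower_sub b (by simp [e2])) (h.lower_sub d (by simp [e2])) hb hd h1
    · exact mem_down_of_lexLe (h.upper_sub b' (by simp [e'])) (h.upper_sub d' (by simp [e']))
        hb' hd' h2
  · intro hq
    constructor
    · have hup : q ∈ Up {x | x ∈ lower} := convexHull_min h.mem_up (convex_up _) hq
      exact cross_nonneg_of_mem_up (hb.trans hd).fst_le
        (fun x hx => h.lower_chain.cross_nonneg e2 hx) hup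
    · have hup : -q ∈ Up {x | x ∈ upper.map Neg.neg} :=
        convexHull_min (t := -Up {x | x ∈ upper.map Neg.neg}) h.neg_mem_up (convex_up _).neg hq
      have := cross_nonneg_of_mem_up (hb'.trans hd').neg.fst_le
        (fun x hx => h.upper_chain.cross_nonneg (u := u'.map Neg.neg) (v := v'.map Neg.neg)
          (by simp [e']) hx) hup
      rw [cross_neg, cross_rotate, cross_swap] at this
      linarith

end Timed

/-! ## Corner triangles of rectangles -/

namespace Rect

theorem mem_region {r : Rect} {p : Pt} : p ∈ r.region ↔
    (r.lo.1 ≤ p.1 ∧ r.lo.2 ≤ p.2) ∧ p.1 ≤ r.hi.1 ∧ p.2 ≤ r.hi.2 := Iff.rfl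

theorem mem_up_bottom {r : Rect} {p : Pt} (hp : p ∈ r.region) {S : Set Pt} (h₁ : r.bl ∈ S)
    (h₂ : r.br ∈ S) : p ∈ Up S := by
  rw [mem_region] at hp
  obtain ⟨⟨h1, h2⟩, h3, h4⟩ := hp
  rcases h1.eq_or_lt with h | h
  · exact mem_up_of_fst_eq h₁ h h2
  · refine mem_up_of_cross_nonneg h₁ h₂ (h.trans_le h3) h1 h3 ?_
    simp only [cross, bl, br, sub_self, zero_mul, sub_zero]
    exact mul_nonneg (by linarith) (by linarith)

theorem mem_down_top {r : Rect} {p : Pt} (hp : p ∈ r.region) {S : Set Pt} (h₁ : r.tl ∈ S)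
    (h₂ : r.tr ∈ S) : p ∈ Down S := by
  rw [mem_region] at hp
  obtain ⟨⟨h1, h2⟩, h3, h4⟩ := hp
  rcases h1.eq_or_lt with h | h
  · exact mem_down_of_fst_eq h₁ h h4
  · refine mem_down_of_cross_nonpos h₁ h₂ (h.trans_le h3) h1 h3 ?_
    simp only [cross, tl, tr, sub_self, zero_mul, sub_zero]
    exact mul_nonpos_of_nonneg_of_nonpos (by linarith) (by linarith)

/-- A point of the triangle is above the bottom side and below the diagonal. Points of the right
side are treated apart, as the diagonal is vertical when the width is zero. -/
theorem SE_subset (r : Rect) : r.SE ⊆ convexHull ℝ {r.bl, r.br, r.tr} := by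
  rintro p ⟨hp, hc⟩
  refine mem_convexHull_of_mem_up_of_mem_down (mem_up_bottom hp (by simp) (by simp)) ?_
  rw [mem_region] at hp
  obtain ⟨⟨h1, h2⟩, h3, h4⟩ := hp
  rcases h3.eq_or_lt with h | h
  · exact mem_down_of_fst_eq (a := r.tr) (by simp) h.symm h4
  · exact mem_down_of_cross_nonpos (a := r.bl) (b := r.tr) (by simp) (by simp)
      (h1.trans_lt h) h1 h3 hc

theorem NE_subset (r : Rect) : r.NE ⊆ convexHull ℝ {r.tl, r.br, r.tr} := by
  rintro p ⟨hp, hc⟩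
  refine mem_convexHull_of_mem_up_of_mem_down ?_ (mem_down_top hp (by simp) (by simp))
  rw [mem_region] at hp
  obtain ⟨⟨h1, h2⟩, h3, h4⟩ := hp
  rcases h3.eq_or_lt with h | h
  · exact mem_up_of_fst_eq (a := r.br) (by simp) h.symm h2
  · exact mem_up_of_cross_nonneg (a := r.tl) (b := r.br) (by simp) (by simp)
      (h1.trans_lt h) h1 h3 hc

theorem NW_subset (r : Rect) : r.NW ⊆ convexHull ℝ {r.tl, r.bl, r.tr} := by
  rintro p ⟨hp, hc⟩
  refine mem_convexHull_of_mem_up_of_mem_down ?_ (mem_down_top hp (by simp) (by simp))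
  rw [mem_region] at hp
  obtain ⟨⟨h1, h2⟩, h3, h4⟩ := hp
  rcases h1.eq_or_lt with h | h
  · exact mem_up_of_fst_eq (a := r.bl) (by simp) h h2
  · exact mem_up_of_cross_nonneg (a := r.bl) (b := r.tr) (by simp) (by simp)
      (h.trans_le h3) h1 h3 hc

theorem SW_subset (r : Rect) : r.SW ⊆ convexHull ℝ {r.tl, r.bl, r.br} := by
  rintro p ⟨hp, hc⟩
  refine mem_convexHull_of_mem_up_of_mem_down (mem_up_bottom hp (by simp) (by simp)) ?_
  rw [mem_region] at hp
  obtain ⟨⟨h1, h2⟩, h3, h4⟩ := hp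
  rcases h1.eq_or_lt with h | h
  · exact mem_down_of_fst_eq (a := r.tl) (by simp) h h4
  · exact mem_down_of_cross_nonpos (a := r.tl) (b := r.br) (by simp) (by simp)
      (h.trans_le h3) h1 h3 hc

theorem region_subset_convexHull (r : Rect) :
    r.region ⊆ convexHull ℝ {r.tl, r.bl, r.br, r.tr} := fun _ hp =>
  mem_convexHull_of_mem_up_of_mem_down (mem_up_bottom hp (by simp) (by simp))
    (mem_down_top hp (by simp) (by simp))

variable {r : Rect}

theorem tl_mem (h : r.lo ≤ r.hi) : r.tl ∈ r.region :=
  ⟨⟨le_rfl, h.2⟩, h.1, le_rfl⟩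

theorem bl_mem (h : r.lo ≤ r.hi) : r.bl ∈ r.region := ⟨le_rfl, h⟩

theorem br_mem (h : r.lo ≤ r.hi) : r.br ∈ r.region :=
  ⟨⟨h.1, le_rfl⟩, le_rfl, h.2⟩

theorem tr_mem (h : r.lo ≤ r.hi) : r.tr ∈ r.region := ⟨h, le_rfl⟩

theorem area_nonneg (h : r.lo ≤ r.hi) : 0 ≤ (r.hi.1 - r.lo.1) * (r.hi.2 - r.lo.2) :=
  mul_nonneg (sub_nonneg.2 h.1) (sub_nonneg.2 h.2)

theorem subset_SE (h : r.lo ≤ r.hi) : {r.bl, r.br, r.tr} ⊆ r.SE := by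
  have := area_nonneg h
  rintro p (rfl | rfl | rfl)
  · refine ⟨bl_mem h, ?_⟩
    simp only [cross, bl, tr]; linarith
  · refine ⟨br_mem h, ?_⟩
    simp only [cross, bl, br, tr]; linarith
  · refine ⟨tr_mem h, ?_⟩
    simp only [cross, bl, tr]; linarith

theorem subset_NE (h : r.lo ≤ r.hi) : {r.tl, r.br, r.tr} ⊆ r.NE := by
  have := area_nonneg h
  rintro p (rfl | rfl | rfl)
  · refine ⟨tl_mem h, ?_⟩
    simp only [cross, tl, br]; linarith
  · refine ⟨br_mem h, ?_⟩
    simp only [cross, tl, br]; linarith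
  · refine ⟨tr_mem h, ?_⟩
    simp only [cross, tl, br, tr]; linarith

theorem subset_NW (h : r.lo ≤ r.hi) : {r.tl, r.bl, r.tr} ⊆ r.NW := by
  have := area_nonneg h
  rintro p (rfl | rfl | rfl)
  · refine ⟨tl_mem h, ?_⟩
    simp only [cross, tl, bl, tr]; linarith
  · refine ⟨bl_mem h, ?_⟩
    simp only [cross, bl, tr]; linarith
  · refine ⟨tr_mem h, ?_⟩
    simp only [cross, bl, tr]; linarith

theorem subset_SW (h : r.lo ≤ r.hi) : {r.tl, r.bl, r.br} ⊆ r.SW := by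
  have := area_nonneg h
  rintro p (rfl | rfl | rfl)
  · refine ⟨tl_mem h, ?_⟩
    simp only [cross, tl, br]; linarith
  · refine ⟨bl_mem h, ?_⟩
    simp only [cross, tl, bl, br]; linarith
  · refine ⟨br_mem h, ?_⟩
    simp only [cross, tl, br]; linarith

end Rect

/-- The vertices `f r`, `g r`, `k r` of the rectangles of a list. -/
def vertexSet (f g k : Rect → Pt) (N : List Rect) : Set Pt :=
  ⋃ r ∈ N, {f r, g r, k r}

/-- The three extra vertices are the same selection `f`, `g`, `k` taken from `B`; this is why the
implementation simply puts `B` in front of the list. -/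
theorem convexHull_iUnion_union_eq {T : Rect → Set Pt} {f g k : Rect → Pt} (B : Rect)
    {N : List Rect} (h₁ : ∀ r, T r ⊆ convexHull ℝ {f r, g r, k r})
    (h₂ : ∀ r ∈ N, {f r, g r, k r} ⊆ T r) :
    convexHull ℝ ((⋃ r ∈ N, T r) ∪ {f B, g B, k B}) =
      convexHull ℝ (vertexSet f g k (B :: N)) := by
  apply subset_antisymm
  · refine convexHull_min (Set.union_subset (Set.iUnion₂_subset fun r hr => ?_) ?_)
      (convex_convexHull ℝ _)
    · refine (h₁ r).trans (convexHull_mono ?_)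
      exact Set.subset_iUnion₂_of_subset r (by simp [hr]) subset_rfl
    · refine Set.Subset.trans ?_ (subset_convexHull ℝ _)
      exact Set.subset_iUnion₂_of_subset B (by simp) subset_rfl
  · refine convexHull_mono (Set.iUnion₂_subset fun r hr => ?_)
    rcases List.mem_cons.1 hr with rfl | hr
    · exact Set.subset_union_right
    · exact Set.Subset.trans (Set.subset_iUnion₂_of_subset r hr (h₂ r hr)) Set.subset_union_left

theorem hullC₁_eq (B : Rect) {N : List Rect} (hN : ∀ r ∈ N, r.lo ≤ r.hi) :
    hullC₁ B N = convexHull ℝ (vertexSet Rect.bl Rect.br Rect.tr (B :: N)) :=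
  convexHull_iUnion_union_eq B Rect.SE_subset fun r hr => Rect.subset_SE (hN r hr)

theorem hullC₂_eq (B : Rect) {N : List Rect} (hN : ∀ r ∈ N, r.lo ≤ r.hi) :
    hullC₂ B N = convexHull ℝ (vertexSet Rect.tl Rect.br Rect.tr (B :: N)) :=
  convexHull_iUnion_union_eq B Rect.NE_subset fun r hr => Rect.subset_NE (hN r hr)

theorem hullC₃_eq (B : Rect) {N : List Rect} (hN : ∀ r ∈ N, r.lo ≤ r.hi) :
    hullC₃ B N = convexHull ℝ (vertexSet Rect.tl Rect.bl Rect.tr (B :: N)) :=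
  convexHull_iUnion_union_eq B Rect.NW_subset fun r hr => Rect.subset_NW (hN r hr)

theorem hullC₄_eq (B : Rect) {N : List Rect} (hN : ∀ r ∈ N, r.lo ≤ r.hi) :
    hullC₄ B N = convexHull ℝ (vertexSet Rect.tl Rect.bl Rect.br (B :: N)) :=
  convexHull_iUnion_union_eq B Rect.SW_subset fun r hr => Rect.subset_SW (hN r hr)

/-- A rectangle is contained in the four hulls as soon as each of them contains the vertex that is
missing in the corresponding corner triangle. -/
theorem region_subset_hulls_iff (B : Rect) {N : List Rect} (hN : ∀ r ∈ N, r.lo ≤ r.hi) {r : Rect}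
    (hr : r ∈ N) :
    r.region ⊆ hullC₁ B N ∩ hullC₂ B N ∩ hullC₃ B N ∩ hullC₄ B N ↔
      r.tl ∈ hullC₁ B N ∧ r.bl ∈ hullC₂ B N ∧ r.br ∈ hullC₃ B N ∧ r.tr ∈ hullC₄ B N := by
  have h := hN r hr
  constructor
  · intro hs
    exact ⟨(hs (Rect.tl_mem h)).1.1.1, (hs (Rect.bl_mem h)).1.1.2, (hs (Rect.br_mem h)).1.2,
      (hs (Rect.tr_mem h)).2⟩
  · rintro ⟨h1, h2, h3, h4⟩
    have key : ∀ {T : Rect → Set Pt} {D : Set Pt} {C : Set Pt},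
        C = convexHull ℝ ((⋃ r ∈ N, T r) ∪ D) → {r.tl, r.bl, r.br, r.tr} ⊆ T r ∪ C →
        r.region ⊆ C := by
      rintro T D C rfl hsub
      refine (Rect.region_subset_convexHull r).trans
        (convexHull_min (hsub.trans (Set.union_subset ?_ subset_rfl)) (convex_convexHull ℝ _))
      refine Set.Subset.trans ?_ (subset_convexHull ℝ _)
      exact Set.Subset.trans (Set.subset_iUnion₂_of_subset r hr subset_rfl) Set.subset_union_left
    have s1 := Rect.subset_SE h
    have s2 := Rect.subset_NE h
    have s3 := Rect.subset_NW h
    have s4 := Rect.subset_SW h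
    simp only [Set.insert_subset_iff, Set.singleton_subset_iff] at s1 s2 s3 s4
    refine Set.subset_inter (Set.subset_inter (Set.subset_inter ?_ ?_) ?_) ?_
    · refine key (T := Rect.SE) rfl ?_
      simp only [Set.insert_subset_iff, Set.singleton_subset_iff, Set.mem_union]
      tauto
    · refine key (T := Rect.NE) rfl ?_
      simp only [Set.insert_subset_iff, Set.singleton_subset_iff, Set.mem_union]
      tauto
    · refine key (T := Rect.NW) rfl ?_
      simp only [Set.insert_subset_iff, Set.singleton_subset_iff, Set.mem_union]
      tauto
    · refine key (T := Rect.SW) rfl ?_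
      simp only [Set.insert_subset_iff, Set.singleton_subset_iff, Set.mem_union]
      tauto

/-! ### The vertex test of the implementation and the discarding rule -/

namespace Timed

theorem mem_gather (f g k : Rect → Pt) (N : List Rect) :
    {p | p ∈ (gather f g k N).val} = vertexSet f g k N := by
  induction N with
  | nil => simp [gather, vertexSet]
  | cons r N ih =>
    have : vertexSet f g k (r :: N) = {f r, g r, k r} ∪ vertexSet f g k N := by
      simp [vertexSet, Set.iUnion_or, Set.iUnion_union_distrib]
    rw [this, ← ih]
    ext p
    simp [gather, or_assoc]

theorem gather_length (f g k : Rect → Pt) (N : List Rect) :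
    (gather f g k N).val.length = 3 * N.length := by
  induction N with
  | nil => rfl
  | cons r N ih => simp [gather, ih]; omega

theorem gather_steps (f g k : Rect → Pt) (N : List Rect) :
    (gather f g k N).steps = N.length + 1 := by
  induction N with
  | nil => rfl
  | cons r N ih => simp [gather, ih]; omega

theorem inHull_gather (f g k : Rect → Pt) (B : Rect) (N : List Rect) (q : Pt) :
    (inHull (hullArrays (gather f g k (B :: N)).val).val q).val = true ↔
      q ∈ convexHull ℝ (vertexSet f g k (B :: N)) := by
  rw [inHull_hullArrays, mem_gather]
  rw [gather_length, List.length_cons]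
  omega

@[simp] theorem rects_val {h : ℕ} (N : List (Item (h + 1))) : (rects N).val = N.map Item.rect := by
  induction N with
  | nil => rfl
  | cons e N ih => simp [rects, ih]

@[simp] theorem rects_steps {h : ℕ} (N : List (Item (h + 1))) :
    (rects N).steps = N.length + 1 := by
  induction N with
  | nil => rfl
  | cons e N ih => simp [rects, ih]; omega

@[simp] theorem children_val {h : ℕ} (N : List (Item (h + 1))) :
    (children N).val = N.flatMap Item.children := by
  induction N with
  | nil => rfl
  | cons e N ih => simp [children, ih]

theorem children_steps {h : ℕ} (N : List (Item (h + 1))) :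
    (children N).steps = 2 * N.length + (N.flatMap Item.children).length + 1 := by
  induction N with
  | nil => rfl
  | cons e N ih =>
    simp only [children, steps_bind, steps_tick, ih, append_steps, List.length_cons,
      List.flatMap_cons, List.length_append]
    omega

theorem keep_val {h : ℕ} (H₁ H₂ H₃ H₄ : Array Pt × Array Pt) (N : List (Item (h + 1))) :
    (keep H₁ H₂ H₃ H₄ N).val = N.filter fun e =>
      !((inHull H₁ e.rect.tl).val && (inHull H₂ e.rect.bl).val &&
        (inHull H₃ e.rect.br).val && (inHull H₄ e.rect.tr).val) := by
  induction N with
  | nil => rfl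
  | cons e N ih =>
    simp only [keep, val_bind, val_ite, val_pure, ih, List.filter_cons]
    cases ((inHull H₁ e.rect.tl).val && (inHull H₂ e.rect.bl).val &&
        (inHull H₃ e.rect.br).val && (inHull H₄ e.rect.tr).val) <;> simp

open Classical in
theorem discard_val {h : ℕ} (B : Rect) (N : List (Item (h + 1)))
    (hN : ∀ e ∈ N, e.rect.lo ≤ e.rect.hi) : (discard B N).val = _root_.discard B N := by
  have hN' : ∀ r ∈ N.map Item.rect, r.lo ≤ r.hi := by simpa using hN
  simp only [discard, val_bind, rects_val, keep_val, _root_.discard]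
  refine List.filter_congr fun e he => ?_
  rw [Bool.eq_iff_iff, decide_eq_true_eq,
    region_subset_hulls_iff B hN' (List.mem_map_of_mem he), hullC₁_eq B hN', hullC₂_eq B hN',
    hullC₃_eq B hN', hullC₄_eq B hN', ← inHull_gather, ← inHull_gather, ← inHull_gather,
    ← inHull_gather]
  simp only [Bool.not_eq_true', Bool.eq_false_iff, ne_eq, Bool.and_eq_true, and_assoc]

end Timed

/-! ## Minimum bounding rectangles -/

/-- The rectangle `r` is the minimum bounding rectangle of `S`. -/
structure Tight (r : Rect) (S : Set Pt) : Prop where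
  sub : S ⊆ r.region
  left : ∃ p ∈ S, p.1 = r.lo.1
  bottom : ∃ p ∈ S, p.2 = r.lo.2
  right : ∃ p ∈ S, p.1 = r.hi.1
  top : ∃ p ∈ S, p.2 = r.hi.2

namespace Tight

variable {r r' : Rect} {S S' : Set Pt}

theorem lo_le_hi (h : Tight r S) : r.lo ≤ r.hi := by
  obtain ⟨p, hp, -⟩ := h.left
  exact (h.sub hp).1.trans (h.sub hp).2

theorem unique (h : Tight r S) (h' : Tight r' S) : r = r' := by
  obtain ⟨p1, hp1, e1⟩ := h.left
  obtain ⟨p2, hp2, e2⟩ := h.bottom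
  obtain ⟨p3, hp3, e3⟩ := h.right
  obtain ⟨p4, hp4, e4⟩ := h.top
  obtain ⟨q1, hq1, f1⟩ := h'.left
  obtain ⟨q2, hq2, f2⟩ := h'.bottom
  obtain ⟨q3, hq3, f3⟩ := h'.right
  obtain ⟨q4, hq4, f4⟩ := h'.top
  have a1 := (h'.sub hp1).1.1
  have a2 := (h'.sub hp2).1.2
  have a3 := (h'.sub hp3).2.1
  have a4 := (h'.sub hp4).2.2
  have b1 := (h.sub hq1).1.1
  have b2 := (h.sub hq2).1.2
  have b3 := (h.sub hq3).2.1
  have b4 := (h.sub hq4).2.2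
  obtain ⟨⟨x, y⟩, z, w⟩ := r
  obtain ⟨⟨x', y'⟩, z', w'⟩ := r'
  simp only at *
  congr <;> linarith

/-- The four extreme coordinates of `X` are attained at points of the finite subset `S`, so infima
and suprema become minima and maxima. -/
theorem mbr {X : Set Pt} (hfin : S.Finite) (hne : S.Nonempty) (hSX : S ⊆ X)
    (h₁ : ∀ x ∈ X, ∃ p ∈ S, p.1 ≤ x.1) (h₂ : ∀ x ∈ X, ∃ p ∈ S, p.2 ≤ x.2)
    (h₃ : ∀ x ∈ X, ∃ p ∈ S, x.1 ≤ p.1) (h₄ : ∀ x ∈ X, ∃ p ∈ S, x.2 ≤ p.2) :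
    Tight (mbr X) S := by
  obtain ⟨p1, hp1, m1⟩ := Set.exists_min_image S Prod.fst hfin hne
  obtain ⟨p2, hp2, m2⟩ := Set.exists_min_image S Prod.snd hfin hne
  obtain ⟨p3, hp3, m3⟩ := Set.exists_max_image S Prod.fst hfin hne
  obtain ⟨p4, hp4, m4⟩ := Set.exists_max_image S Prod.snd hfin hne
  have e1 : sInf (Prod.fst '' X) = p1.1 := by
    refine IsLeast.csInf_eq ⟨Set.mem_image_of_mem _ (hSX hp1), ?_⟩
    rintro _ ⟨x, hx, rfl⟩
    obtain ⟨p, hp, hpx⟩ := h₁ x hx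
    exact (m1 p hp).trans hpx
  have e2 : sInf (Prod.snd '' X) = p2.2 := by
    refine IsLeast.csInf_eq ⟨Set.mem_image_of_mem _ (hSX hp2), ?_⟩
    rintro _ ⟨x, hx, rfl⟩
    obtain ⟨p, hp, hpx⟩ := h₂ x hx
    exact (m2 p hp).trans hpx
  have e3 : sSup (Prod.fst '' X) = p3.1 := by
    refine IsGreatest.csSup_eq ⟨Set.mem_image_of_mem _ (hSX hp3), ?_⟩
    rintro _ ⟨x, hx, rfl⟩
    obtain ⟨p, hp, hpx⟩ := h₃ x hx
    exact hpx.trans (m3 p hp)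
  have e4 : sSup (Prod.snd '' X) = p4.2 := by
    refine IsGreatest.csSup_eq ⟨Set.mem_image_of_mem _ (hSX hp4), ?_⟩
    rintro _ ⟨x, hx, rfl⟩
    obtain ⟨p, hp, hpx⟩ := h₄ x hx
    exact hpx.trans (m4 p hp)
  unfold _root_.mbr
  rw [e1, e2, e3, e4]
  exact ⟨fun p hp => ⟨⟨m1 p hp, m2 p hp⟩, m3 p hp, m4 p hp⟩, ⟨p1, hp1, rfl⟩, ⟨p2, hp2, rfl⟩,
    ⟨p3, hp3, rfl⟩, ⟨p4, hp4, rfl⟩⟩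

end Tight

namespace Item

/-- The rectangle of an item, a point being regarded as a degenerate rectangle. -/
def box : (h : ℕ) → Item h → Rect
  | 0, p => ⟨p, p⟩
  | _ + 1, e => rect e

theorem region_eq_box : (h : ℕ) → (x : Item h) → region h x = (box h x).region
  | 0, p => (Set.Icc_self (α := Pt) p).symm
  | _ + 1, _ => rfl

/-- The set of points stored below the items of a list. -/
def pointSet {h : ℕ} (l : List (Item h)) : Set Pt := {p | p ∈ l.flatMap (points h)}

theorem finite_pointSet {h : ℕ} (l : List (Item h)) : (pointSet l).Finite := List.finite_toSet _

theorem mem_pointSet {h : ℕ} {l : List (Item h)} {p : Pt} :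
    p ∈ pointSet l ↔ ∃ x ∈ l, p ∈ points h x := List.mem_flatMap

/-- Every side of a child rectangle touches a stored point, so bounding the rectangles amounts to
bounding the points below them. -/
theorem tight_mbr_cover {h : ℕ} {l : List (Item h)} (hl : l ≠ [])
    (ht : ∀ x ∈ l, Tight (box h x) {p | p ∈ points h x}) :
    Tight (mbr (cover l)) (pointSet l) := by
  have hX : ∀ {q}, q ∈ cover l → ∃ x ∈ l, q ∈ (box h x).region := by
    intro q hq
    simp only [cover, Set.mem_iUnion, exists_prop] at hq
    simpa only [region_eq_box] using hq
  refine Tight.mbr (finite_pointSet l) ?_ ?_ ?_ ?_ ?_ ?_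
  · obtain ⟨x, hx⟩ := List.exists_mem_of_ne_nil l hl
    obtain ⟨p, hp, -⟩ := (ht x hx).left
    exact ⟨p, mem_pointSet.2 ⟨x, hx, hp⟩⟩
  · intro p hp
    obtain ⟨x, hx, hpx⟩ := mem_pointSet.1 hp
    simp only [cover, Set.mem_iUnion, exists_prop]
    exact ⟨x, hx, region_eq_box h x ▸ (ht x hx).sub hpx⟩
  all_goals
    intro q hq
    obtain ⟨x, hx, hqx⟩ := hX hq
  · obtain ⟨p, hp, e⟩ := (ht x hx).left
    exact ⟨p, mem_pointSet.2 ⟨x, hx, hp⟩, e.trans_le hqx.1.1⟩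
  · obtain ⟨p, hp, e⟩ := (ht x hx).bottom
    exact ⟨p, mem_pointSet.2 ⟨x, hx, hp⟩, e.trans_le hqx.1.2⟩
  · obtain ⟨p, hp, e⟩ := (ht x hx).right
    exact ⟨p, mem_pointSet.2 ⟨x, hx, hp⟩, hqx.2.1.trans_eq e.symm⟩
  · obtain ⟨p, hp, e⟩ := (ht x hx).top
    exact ⟨p, mem_pointSet.2 ⟨x, hx, hp⟩, hqx.2.2.trans_eq e.symm⟩

theorem Valid.tight {m M : ℕ} (hm : 2 ≤ m) : {h : ℕ} → {x : Item h} → Valid m M h x →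
    Tight (box h x) {p | p ∈ points h x}
  | 0, x, _ => by
    refine ⟨fun p hp => ?_, ⟨x, ?_, rfl⟩, ⟨x, ?_, rfl⟩, ⟨x, ?_, rfl⟩, ⟨x, ?_, rfl⟩⟩
    · rw [List.mem_singleton.1 hp]
      exact ⟨le_rfl, le_rfl⟩
    all_goals exact List.mem_singleton.2 rfl
  | h + 1, e, he => by
    obtain ⟨h1, -, h2, h3⟩ := he
    change Tight (rect e) (pointSet (children e))
    rw [h2]
    refine tight_mbr_cover ?_ fun x hx => (h3 x hx).tight hm
    rintro h0
    rw [h0] at h1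
    simp at h1
    omega

theorem Valid.children {m M h : ℕ} {N : List (Item (h + 1))} (hN : ∀ e ∈ N, Valid m M (h + 1) e) :
    ∀ x ∈ N.flatMap Item.children, Valid m M h x := by
  intro x hx
  obtain ⟨e, he, hxe⟩ := List.mem_flatMap.1 hx
  exact (hN e he).2.2.2 x hxe

end Item

theorem mem_of_mem_discard {h : ℕ} {B : Rect} {N : List (Item (h + 1))} {e : Item (h + 1)}
    (he : e ∈ discard B N) : e ∈ N := List.mem_of_mem_filter he

namespace Timed

theorem descend_val {m M : ℕ} (hm : 2 ≤ m) (B : Rect) (h : ℕ) (N : List (Item h))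
    (hN : ∀ x ∈ N, x.Valid m M h) : (descend B h N).val = _root_.descend B h N := by
  induction h with
  | zero => rfl
  | succ h ih =>
    have hd := discard_val B N fun e he => ((hN e he).tight hm).lo_le_hi
    simp only [descend, val_bind, val_pure, rects_val, children_val, hd, _root_.descend]
    rw [ih _ (Item.Valid.children fun e he => hN e (mem_of_mem_discard he))]

theorem bound_tight {h : ℕ} (N : List (Item (h + 1)))
    (hN : ∀ e ∈ N, Tight e.rect {p | p ∈ e.points (h + 1)}) (B : Rect) (S : Set Pt)
    (hB : Tight B S) : Tight (bound B (N.map Item.rect)).val (S ∪ Item.pointSet N) := by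
  induction N generalizing B S with
  | nil => simpa [bound, Item.pointSet] using hB
  | cons e N ih =>
    have hS : S ∪ Item.pointSet (e :: N) =
        (S ∪ {p | p ∈ e.points (h + 1)}) ∪ Item.pointSet N := by
      ext p
      simp [Item.pointSet, or_assoc]
    rw [hS]
    simp only [List.map_cons, bound, val_bind, val_lt, decide_eq_true_eq]
    refine ih (fun x hx => hN x (by simp [hx])) _ _ ?_
    have he := hN e (by simp)
    generalize {p | p ∈ e.points (h + 1)} = T at *
    generalize e.rect = r at *
    constructor
    · rintro p (hp | hp)
      · have := Rect.mem_region.1 (hB.sub hp)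
        rw [Rect.mem_region]
        dsimp only
        split_ifs <;> grind
      · have := Rect.mem_region.1 (he.sub hp)
        rw [Rect.mem_region]
        dsimp only
        split_ifs <;> grind
    · dsimp only
      split_ifs
      · obtain ⟨p, hp, e⟩ := he.left
        exact ⟨p, Or.inr hp, e⟩
      · obtain ⟨p, hp, e⟩ := hB.left
        exact ⟨p, Or.inl hp, e⟩
    · dsimp only
      split_ifs
      · obtain ⟨p, hp, e⟩ := he.bottom
        exact ⟨p, Or.inr hp, e⟩
      · obtain ⟨p, hp, e⟩ := hB.bottom
        exact ⟨p, Or.inl hp, e⟩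
    · dsimp only
      split_ifs
      · obtain ⟨p, hp, e⟩ := he.right
        exact ⟨p, Or.inr hp, e⟩
      · obtain ⟨p, hp, e⟩ := hB.right
        exact ⟨p, Or.inl hp, e⟩
    · dsimp only
      split_ifs
      · obtain ⟨p, hp, e⟩ := he.top
        exact ⟨p, Or.inr hp, e⟩
      · obtain ⟨p, hp, e⟩ := hB.top
        exact ⟨p, Or.inl hp, e⟩

/-- The rectangle found by comparisons and the one defined by infima and suprema are both tight for
the same stored points, hence equal. -/
theorem boundingRect_val {h : ℕ} {N : List (Item (h + 1))} (hne : N ≠ [])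
    (hN : ∀ e ∈ N, Tight e.rect {p | p ∈ e.points (h + 1)}) :
    (boundingRect (N.map Item.rect)).val = mbr (Item.cover N) := by
  refine Tight.unique (S := Item.pointSet N) ?_ (Item.tight_mbr_cover hne hN)
  cases N with
  | nil => exact absurd rfl hne
  | cons e N =>
    have := bound_tight N (fun x hx => hN x (by simp [hx])) _ _ (hN e (by simp))
    simp only [List.map_cons, boundingRect, val_bind]
    convert this using 1
    ext p
    simp [Item.pointSet]

end Timed

/-! ## Points that survive the descent -/

namespace Item

theorem flatMap_points_zero (N : List (Item 0)) : N.flatMap (points 0) = N :=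
  List.flatMap_singleton' (α := Pt) N

theorem flatMap_children_points {h : ℕ} (N : List (Item (h + 1))) :
    (N.flatMap children).flatMap (points h) = N.flatMap (points (h + 1)) :=
  List.flatMap_assoc

theorem flatMap_points_sublist {h : ℕ} {K N : List (Item h)} (hKN : K.Sublist N) :
    (K.flatMap (points h)).Sublist (N.flatMap (points h)) := by
  simp only [List.flatMap_def]
  exact (hKN.map _).flatten

end Item

theorem discard_sublist {h : ℕ} (B : Rect) (N : List (Item (h + 1))) :
    (discard B N).Sublist N := List.filter_sublist

theorem descend_sublist (B : Rect) (h : ℕ) (N : List (Item h)) :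
    (descend B h N).2.Sublist (N.flatMap (Item.points h)) := by
  induction h with
  | zero => rw [Item.flatMap_points_zero]; exact List.Sublist.refl N
  | succ h ih =>
    refine (ih _).trans ?_
    rw [Item.flatMap_children_points]
    exact Item.flatMap_points_sublist (discard_sublist B N)

/-! ## Supporting lines at the vertices -/

/-- Hahn–Banach separates `p` from the hull of the other points. The finitely many strict
inequalities survive adding a small `ε` to both coefficients, which makes both nonzero; their signs
are needed to select a corner. -/
theorem exists_strict_support {S : Set Pt} (hS : S.Finite) {p : Pt}
    (hp : p ∈ (convexHull ℝ S).extremePoints ℝ) :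
    ∃ α β : ℝ, α ≠ 0 ∧ β ≠ 0 ∧
      ∀ q ∈ S, q ≠ p → α * q.1 + β * q.2 < α * p.1 + β * p.2 := by
  have hnot : p ∉ convexHull ℝ (S \ {p}) := fun hc =>
    (((convex_convexHull ℝ S).mem_extremePoints_iff_mem_sdiff_convexHull_sdiff).1 hp).2
      (convexHull_mono (Set.sdiff_subset_sdiff_left (subset_convexHull ℝ S)) hc)
  obtain ⟨f, u, hf, hu⟩ := geometric_hahn_banach_closed_point (convex_convexHull ℝ (S \ {p}))
    ((hS.sdiff).isCompact_convexHull ℝ).isClosed hnot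
  have hfe : ∀ q : Pt, f q = f (1, 0) * q.1 + f (0, 1) * q.2 := by
    intro q
    have : q = q.1 • ((1, 0) : Pt) + q.2 • ((0, 1) : Pt) := by ext <;> simp
    conv_lhs => rw [this]
    rw [map_add, map_smul, map_smul, smul_eq_mul, smul_eq_mul]
    ring
  have hne : ∀ a : ℝ, ∀ᶠ ε in nhdsWithin (0 : ℝ) (Set.Ioi 0), a + ε ≠ 0 := by
    intro a
    rcases eq_or_ne a 0 with rfl | ha
    · filter_upwards [self_mem_nhdsWithin] with ε hε
      simpa using (ne_of_gt hε)
    · refine nhdsWithin_le_nhds (ContinuousAt.eventually_ne (g := fun ε => a + ε) (by fun_prop) ?_)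
      simpa using ha
  have hlt : ∀ᶠ ε in nhdsWithin (0 : ℝ) (Set.Ioi 0), ∀ q ∈ S \ {p},
      (f (1, 0) + ε) * q.1 + (f (0, 1) + ε) * q.2 <
        (f (1, 0) + ε) * p.1 + (f (0, 1) + ε) * p.2 := by
    rw [Set.Finite.eventually_all hS.sdiff]
    intro q hq
    refine nhdsWithin_le_nhds (ContinuousAt.eventually_lt (by fun_prop) (by fun_prop) ?_)
    rw [add_zero, add_zero, ← hfe, ← hfe]
    exact (hf q (subset_convexHull ℝ _ hq)).trans hu
  obtain ⟨ε, h1, h2, h3⟩ := ((hne (f (1, 0))).and ((hne (f (0, 1))).and hlt)).exists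
  exact ⟨_, _, h1, h2, fun q hq hqp => h3 q ⟨hq, hqp⟩⟩

theorem notMem_convexHull_of_lt {S : Set Pt} {α β : ℝ} {x : Pt}
    (h : ∀ y ∈ S, α * y.1 + β * y.2 < α * x.1 + β * x.2) : x ∉ convexHull ℝ S := by
  intro hx
  have hconv : Convex ℝ {y : Pt | α * y.1 + β * y.2 < α * x.1 + β * x.2} := by
    refine convex_halfSpace_lt (f := fun y : Pt => α * y.1 + β * y.2) ⟨?_, ?_⟩ _
    · intro y z; simp only [Prod.fst_add, Prod.snd_add]; ring
    · intro c y; simp only [Prod.smul_fst, Prod.smul_snd, smul_eq_mul]; ring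
  have : α * x.1 + β * x.2 < α * x.1 + β * x.2 := convexHull_min h hconv hx
  exact lt_irrefl _ this

/-- The values of the functional increase along `x`, `q`, `p`, `c`. The middle step is strict unless
`q = p`, and then `hp` supplies a strict step. -/
theorem corner_lt {α β : ℝ} {p q x c : Pt}
    (hmax : q ≠ p → α * q.1 + β * q.2 < α * p.1 + β * p.2)
    (hx₁ : α * x.1 ≤ α * q.1) (hx₂ : β * x.2 ≤ β * q.2)
    (hc₁ : α * p.1 ≤ α * c.1) (hc₂ : β * p.2 ≤ β * c.2)
    (hp : q = p → α * x.1 < α * c.1 ∨ β * x.2 < β * c.2) :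
    α * x.1 + β * x.2 < α * c.1 + β * c.2 := by
  by_cases hqp : q = p
  · have := hp hqp
    subst hqp
    rcases this with h | h <;> linarith
  · have := hmax hqp
    linarith

/-- In each coordinate, `r` starts before `R` ends and `R` starts before `r` ends. -/
def Rect.Overlaps (r R : Rect) : Prop :=
  (r.lo.1 < R.hi.1 ∧ r.lo.2 < R.hi.2) ∧ R.lo.1 < r.hi.1 ∧ R.lo.2 < r.hi.2

section Corners

variable {α β : ℝ} {p : Pt} {r R : Rect} {S : Set Pt}

/-- The left vertices are dominated by a stored point on the top side, the bottom-right one by a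
stored point on the right side. If that point is `p`, then `p ∈ S` and the overlap gives strictness.
The other three corners are symmetric. -/
theorem corner_lt_tr (hα : 0 < α) (hβ : 0 < β)
    (hmax : ∀ q ∈ S, q ≠ p → α * q.1 + β * q.2 < α * p.1 + β * p.2) (hr : Tight r S)
    (hR : p ∈ R.region) (hp : p ∈ S → r.Overlaps R) {x : Pt}
    (hx : x ∈ ({r.tl, r.bl, r.br} : Set Pt)) :
    α * x.1 + β * x.2 < α * R.tr.1 + β * R.tr.2 := by
  have hl := hr.lo_le_hi
  obtain ⟨t, ht, et⟩ := hr.top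
  obtain ⟨s, hs, es⟩ := hr.right
  have c1 : α * p.1 ≤ α * R.tr.1 := mul_le_mul_of_nonneg_left hR.2.1 hα.le
  have c2 : β * p.2 ≤ β * R.tr.2 := mul_le_mul_of_nonneg_left hR.2.2 hβ.le
  rcases hx with rfl | rfl | rfl
  · exact corner_lt (hmax t ht) (mul_le_mul_of_nonneg_left (hr.sub ht).1.1 hα.le)
      (mul_le_mul_of_nonneg_left et.ge hβ.le) c1 c2
      fun e => Or.inl (mul_lt_mul_of_pos_left (hp (e ▸ ht)).1.1 hα)
  · exact corner_lt (hmax t ht) (mul_le_mul_of_nonneg_left (hr.sub ht).1.1 hα.le)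
      (mul_le_mul_of_nonneg_left (hl.2.trans et.ge) hβ.le) c1 c2
      fun e => Or.inl (mul_lt_mul_of_pos_left (hp (e ▸ ht)).1.1 hα)
  · exact corner_lt (hmax s hs) (mul_le_mul_of_nonneg_left es.ge hα.le)
      (mul_le_mul_of_nonneg_left (hr.sub hs).1.2 hβ.le) c1 c2
      fun e => Or.inr (mul_lt_mul_of_pos_left (hp (e ▸ hs)).1.2 hβ)

theorem corner_lt_tl (hα : α < 0) (hβ : 0 < β)
    (hmax : ∀ q ∈ S, q ≠ p → α * q.1 + β * q.2 < α * p.1 + β * p.2) (hr : Tight r S)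
    (hR : p ∈ R.region) (hp : p ∈ S → r.Overlaps R) {x : Pt}
    (hx : x ∈ ({r.bl, r.br, r.tr} : Set Pt)) :
    α * x.1 + β * x.2 < α * R.tl.1 + β * R.tl.2 := by
  have hl := hr.lo_le_hi
  obtain ⟨t, ht, et⟩ := hr.top
  obtain ⟨s, hs, es⟩ := hr.left
  have c1 : α * p.1 ≤ α * R.tl.1 := mul_le_mul_of_nonpos_left hR.1.1 hα.le
  have c2 : β * p.2 ≤ β * R.tl.2 := mul_le_mul_of_nonneg_left hR.2.2 hβ.le
  rcases hx with rfl | rfl | rfl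
  · exact corner_lt (hmax s hs) (mul_le_mul_of_nonpos_left es.le hα.le)
      (mul_le_mul_of_nonneg_left (hr.sub hs).1.2 hβ.le) c1 c2
      fun e => Or.inr (mul_lt_mul_of_pos_left (hp (e ▸ hs)).1.2 hβ)
  · exact corner_lt (hmax t ht) (mul_le_mul_of_nonpos_left (hr.sub ht).2.1 hα.le)
      (mul_le_mul_of_nonneg_left (hl.2.trans et.ge) hβ.le) c1 c2
      fun e => Or.inl (mul_lt_mul_of_neg_left (hp (e ▸ ht)).2.1 hα)
  · exact corner_lt (hmax t ht) (mul_le_mul_of_nonpos_left (hr.sub ht).2.1 hα.le)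
      (mul_le_mul_of_nonneg_left et.ge hβ.le) c1 c2
      fun e => Or.inl (mul_lt_mul_of_neg_left (hp (e ▸ ht)).2.1 hα)

theorem corner_lt_bl (hα : α < 0) (hβ : β < 0)
    (hmax : ∀ q ∈ S, q ≠ p → α * q.1 + β * q.2 < α * p.1 + β * p.2) (hr : Tight r S)
    (hR : p ∈ R.region) (hp : p ∈ S → r.Overlaps R) {x : Pt}
    (hx : x ∈ ({r.tl, r.br, r.tr} : Set Pt)) :
    α * x.1 + β * x.2 < α * R.bl.1 + β * R.bl.2 := by
  have hl := hr.lo_le_hi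
  obtain ⟨t, ht, et⟩ := hr.bottom
  obtain ⟨s, hs, es⟩ := hr.left
  have c1 : α * p.1 ≤ α * R.bl.1 := mul_le_mul_of_nonpos_left hR.1.1 hα.le
  have c2 : β * p.2 ≤ β * R.bl.2 := mul_le_mul_of_nonpos_left hR.1.2 hβ.le
  rcases hx with rfl | rfl | rfl
  · exact corner_lt (hmax s hs) (mul_le_mul_of_nonpos_left es.le hα.le)
      (mul_le_mul_of_nonpos_left (hr.sub hs).2.2 hβ.le) c1 c2
      fun e => Or.inr (mul_lt_mul_of_neg_left (hp (e ▸ hs)).2.2 hβ)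
  · exact corner_lt (hmax t ht) (mul_le_mul_of_nonpos_left (hr.sub ht).2.1 hα.le)
      (mul_le_mul_of_nonpos_left et.le hβ.le) c1 c2
      fun e => Or.inl (mul_lt_mul_of_neg_left (hp (e ▸ ht)).2.1 hα)
  · exact corner_lt (hmax s hs) (mul_le_mul_of_nonpos_left (es.le.trans hl.1) hα.le)
      (mul_le_mul_of_nonpos_left (hr.sub hs).2.2 hβ.le) c1 c2
      fun e => Or.inr (mul_lt_mul_of_neg_left (hp (e ▸ hs)).2.2 hβ)

theorem corner_lt_br (hα : 0 < α) (hβ : β < 0)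
    (hmax : ∀ q ∈ S, q ≠ p → α * q.1 + β * q.2 < α * p.1 + β * p.2) (hr : Tight r S)
    (hR : p ∈ R.region) (hp : p ∈ S → r.Overlaps R) {x : Pt}
    (hx : x ∈ ({r.tl, r.bl, r.tr} : Set Pt)) :
    α * x.1 + β * x.2 < α * R.br.1 + β * R.br.2 := by
  have hl := hr.lo_le_hi
  obtain ⟨t, ht, et⟩ := hr.bottom
  obtain ⟨s, hs, es⟩ := hr.right
  have c1 : α * p.1 ≤ α * R.br.1 := mul_le_mul_of_nonneg_left hR.2.1 hα.le
  have c2 : β * p.2 ≤ β * R.br.2 := mul_le_mul_of_nonpos_left hR.1.2 hβ.le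
  rcases hx with rfl | rfl | rfl
  · exact corner_lt (hmax t ht) (mul_le_mul_of_nonneg_left (hr.sub ht).1.1 hα.le)
      (mul_le_mul_of_nonpos_left (et.le.trans hl.2) hβ.le) c1 c2
      fun e => Or.inl (mul_lt_mul_of_pos_left (hp (e ▸ ht)).1.1 hα)
  · exact corner_lt (hmax t ht) (mul_le_mul_of_nonneg_left (hr.sub ht).1.1 hα.le)
      (mul_le_mul_of_nonpos_left et.le hβ.le) c1 c2
      fun e => Or.inl (mul_lt_mul_of_pos_left (hp (e ▸ ht)).1.1 hα)
  · exact corner_lt (hmax s hs) (mul_le_mul_of_nonneg_left es.ge hα.le)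
      (mul_le_mul_of_nonpos_left (hr.sub hs).2.2 hβ.le) c1 c2
      fun e => Or.inr (mul_lt_mul_of_neg_left (hp (e ▸ hs)).2.2 hβ)

end Corners

/-- A rectangle above a vertex of the convex hull is not contained in the four hulls. -/
theorem not_region_subset_hulls {B R : Rect} {N : List Rect} {P : Set Pt} {p : Pt}
    (hP : P.Finite) (hp : p ∈ (convexHull ℝ P).extremePoints ℝ) (hRN : R ∈ N) (hpR : p ∈ R.region)
    (hN : ∀ r ∈ B :: N, ∃ S ⊆ P, Tight r S ∧ (p ∈ S → r.Overlaps R)) :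
    ¬ R.region ⊆ hullC₁ B N ∩ hullC₂ B N ∩ hullC₃ B N ∩ hullC₄ B N := by
  have hle : ∀ r ∈ N, r.lo ≤ r.hi := by
    intro r hr
    obtain ⟨S, -, hS, -⟩ := hN r (by simp [hr])
    exact hS.lo_le_hi
  rw [region_subset_hulls_iff B hle hRN, hullC₁_eq B hle, hullC₂_eq B hle, hullC₃_eq B hle,
    hullC₄_eq B hle]
  rintro ⟨h1, h2, h3, h4⟩
  obtain ⟨α, β, hα, hβ, hmax⟩ := exists_strict_support hP hp
  -- The signs tell which corner of `R` is furthest in the supporting direction; that corner escapes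
  -- the hull generated by the other three corner types.
  rcases hα.lt_or_gt with hα | hα <;> rcases hβ.lt_or_gt with hβ | hβ
  · refine notMem_convexHull_of_lt (α := α) (β := β) (fun y hy => ?_) h2
    obtain ⟨r, hr, hyr⟩ := Set.mem_iUnion₂.1 hy
    obtain ⟨S, hSP, hS, hov⟩ := hN r hr
    exact corner_lt_bl hα hβ (fun q hq => hmax q (hSP hq)) hS hpR hov hyr
  · refine notMem_convexHull_of_lt (α := α) (β := β) (fun y hy => ?_) h1
    obtain ⟨r, hr, hyr⟩ := Set.mem_iUnion₂.1 hy
    obtain ⟨S, hSP, hS, hov⟩ := hN r hr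
    exact corner_lt_tl hα hβ (fun q hq => hmax q (hSP hq)) hS hpR hov hyr
  · refine notMem_convexHull_of_lt (α := α) (β := β) (fun y hy => ?_) h3
    obtain ⟨r, hr, hyr⟩ := Set.mem_iUnion₂.1 hy
    obtain ⟨S, hSP, hS, hov⟩ := hN r hr
    exact corner_lt_br hα hβ (fun q hq => hmax q (hSP hq)) hS hpR hov hyr
  · refine notMem_convexHull_of_lt (α := α) (β := β) (fun y hy => ?_) h4
    obtain ⟨r, hr, hyr⟩ := Set.mem_iUnion₂.1 hy
    obtain ⟨S, hSP, hS, hov⟩ := hN r hr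
    exact corner_lt_tr hα hβ (fun q hq => hmax q (hSP hq)) hS hpR hov hyr

theorem extremePoint_mem_discard {m M h : ℕ} (hm : 2 ≤ m) {B : Rect} {P : Set Pt} (hP : P.Finite)
    (hB : Tight B P) {N : List (Item (h + 1))} (hN : ∀ e ∈ N, e.Valid m M (h + 1))
    (hprop : ∀ e ∈ N, e.rect.Proper) (hnd : (N.flatMap (Item.points (h + 1))).Nodup)
    (hNP : Item.pointSet N ⊆ P) {p : Pt} (hp : p ∈ (convexHull ℝ P).extremePoints ℝ)
    (hpN : p ∈ Item.pointSet N) : p ∈ Item.pointSet (discard B N) := by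
  obtain ⟨e, he, hpe⟩ := Item.mem_pointSet.1 hpN
  refine Item.mem_pointSet.2 ⟨e, ?_, hpe⟩
  have ht : ∀ e ∈ N, Tight e.rect {q | q ∈ e.points (h + 1)} := fun e he => (hN e he).tight hm
  have hsub : ∀ e ∈ N, {q | q ∈ e.points (h + 1)} ⊆ P := fun e he q hq =>
    hNP (Item.mem_pointSet.2 ⟨e, he, hq⟩)
  refine List.mem_filter.2 ⟨he, ?_⟩
  classical
  simp only [decide_eq_true_eq]
  refine not_region_subset_hulls hP hp (List.mem_map_of_mem he) ((ht e he).sub hpe) ?_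
  intro r hr
  obtain ⟨w1, w2⟩ := hprop e he
  rcases List.mem_cons.1 hr with rfl | hr
  · refine ⟨P, subset_rfl, hB, fun _ => ?_⟩
    obtain ⟨q1, hq1, e1⟩ := (ht e he).left
    obtain ⟨q2, hq2, e2⟩ := (ht e he).bottom
    obtain ⟨q3, hq3, e3⟩ := (ht e he).right
    obtain ⟨q4, hq4, e4⟩ := (ht e he).top
    have b1 := (hB.sub (hsub e he hq1)).1.1
    have b2 := (hB.sub (hsub e he hq2)).1.2
    have b3 := (hB.sub (hsub e he hq3)).2.1
    have b4 := (hB.sub (hsub e he hq4)).2.2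
    exact ⟨⟨by linarith, by linarith⟩, by linarith, by linarith⟩
  · obtain ⟨e', he', rfl⟩ := List.mem_map.1 hr
    refine ⟨_, hsub e' he', ht e' he', fun hpe' => ?_⟩
    -- Another rectangle may contain `p` geometrically, but only one entry stores it, since the
    -- leaves have no repetition. Overlap is thus needed only of `e` with itself, where it is
    -- positive width and height.
    obtain rfl : e' = e := by
      by_contra hne
      have hdisj := (List.nodup_flatMap.1 hnd).2
      have : Std.Symm (Function.onFun List.Disjoint (Item.points (h + 1))) :=
        ⟨fun _ _ hd => List.Disjoint.symm hd⟩
      exact hdisj.forall he' he hne hpe' hpe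
    exact ⟨⟨w1, w2⟩, w1, w2⟩

theorem extremePoint_mem_descend {m M : ℕ} (hm : 2 ≤ m) {B : Rect} {P : Set Pt} (hP : P.Finite)
    (hB : Tight B P) (h : ℕ) (N : List (Item h)) (hN : ∀ x ∈ N, x.Valid m M h)
    (hprop : ∀ x ∈ N, x.AllProper h) (hnd : (N.flatMap (Item.points h)).Nodup)
    (hNP : Item.pointSet N ⊆ P) {p : Pt} (hp : p ∈ (convexHull ℝ P).extremePoints ℝ)
    (hpN : p ∈ Item.pointSet N) : p ∈ (descend B h N).2 := by
  induction h with
  | zero =>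
    change p ∈ N.flatMap (Item.points 0) at hpN
    rwa [Item.flatMap_points_zero] at hpN
  | succ h ih =>
    have hsub := Item.flatMap_points_sublist (discard_sublist B N)
    refine ih _ (Item.Valid.children fun e he => hN e (mem_of_mem_discard he)) ?_ ?_ ?_ ?_
    · intro x hx
      obtain ⟨e, he, hxe⟩ := List.mem_flatMap.1 hx
      exact (hprop e (mem_of_mem_discard he)).2 x hxe
    · rw [Item.flatMap_children_points]
      exact hnd.sublist hsub
    · rw [Item.pointSet, Item.flatMap_children_points]
      exact fun q hq => hNP (hsub.mem hq)
    · have := extremePoint_mem_discard hm hP hB hN (fun e he => (hprop e he).1) hnd hNP hp hpN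
      rw [Item.pointSet, Item.flatMap_children_points]
      exact this

/-! ## Step counts -/

namespace Timed

theorem chains_length_le (l : List Pt) :
    (chains l).val.1.length ≤ l.length ∧ (chains l).val.2.length ≤ l.length := by
  rw [chains_val]
  have h1 := scan_length_le [] (mergeSort l).val
  have h2 := scan_length_le [] (mergeSort l).val.reverse
  simp only [List.length_nil, List.length_reverse, (mergeSort_perm l).length_eq, zero_add] at h1 h2
  exact ⟨h1, h2⟩

theorem chains_steps (l : List Pt) :
    (chains l).steps ≤ 12 * (l.length * Nat.clog 2 l.length) + 43 * l.length + 5 := by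
  have h1 := scan_steps [] (mergeSort l).val
  have h2 := scan_steps [] (mergeSort l).val.reverse
  have h3 := mergeSort_steps l
  simp only [List.length_nil, List.length_reverse, (mergeSort_perm l).length_eq] at h1 h2
  simp only [chains, steps_bind, steps_tick, steps_pure, revOnto_steps, revOnto_val,
    List.append_nil, (mergeSort_perm l).length_eq]
  omega

theorem hullArrays_steps (l : List Pt) :
    (hullArrays l).steps ≤ 12 * (l.length * Nat.clog 2 l.length) + 46 * l.length + 9 := by
  have h1 := chains_steps l
  have h2 := chains_length_le l
  simp only [hullArrays, steps_bind, steps_tick, steps_pure, revOnto_steps, revOnto_val,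
    List.append_nil, steps_toArray, List.length_reverse]
  omega

theorem polygon_steps (l : List Pt) :
    (polygon l).steps ≤ 12 * (l.length * Nat.clog 2 l.length) + 45 * l.length + 8 := by
  match l with
  | [] => simp [polygon]
  | [p] => simp [polygon]
  | p :: q :: l =>
    have h1 := chains_steps (p :: q :: l)
    have h2 := chains_length_le (p :: q :: l)
    have hs : (polygon (p :: q :: l)).steps = 1 + ((chains (p :: q :: l)).steps +
        (((chains (p :: q :: l)).val.2.length - 1 + 1) +
          ((chains (p :: q :: l)).val.1.length - 1 + 1))) := by
      simp [polygon]
    rw [hs]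
    generalize (p :: q :: l).length = k at *
    omega

theorem side_steps (A : Array Pt) (q : Pt) : (side A q).steps ≤ 6 * Nat.clog 2 A.size + 12 := by
  simp only [side, steps_bind, steps_tick, steps_get, steps_cross]
  have h1 := search_steps A q 0 (A.size - 1)
  have h2 : Nat.clog 2 (A.size - 1 - 0) ≤ Nat.clog 2 A.size := Nat.clog_mono_right 2 (by omega)
  omega

theorem inHull_steps (l : List Pt) (q : Pt) :
    (inHull (hullArrays l).val q).steps ≤ 12 * Nat.clog 2 l.length + 37 := by
  rw [hullArrays_val]
  obtain ⟨h1, h2⟩ := chains_length_le l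
  generalize (chains l).val.1 = lower at *
  generalize (chains l).val.2 = upper at *
  have s1 := side_steps lower.reverse.toArray q
  have s2 := side_steps upper.toArray q
  rw [List.size_toArray] at s1 s2
  rw [List.length_reverse] at s1
  have c1 := Nat.clog_mono_right 2 h1
  have c2 := Nat.clog_mono_right 2 h2
  simp only [inHull, steps_bind, steps_ite, steps_tick, steps_get, steps_le, steps_pure, val_get]
  generalize lower.reverse.toArray.getD 0 (0, 0) = a at *
  generalize lower.reverse.toArray.getD (lower.reverse.toArray.size - 1) (0, 0) = z at *
  have l1 := lexLe_steps a q
  have l2 := lexLe_steps q z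
  split_ifs <;> omega

theorem keep_steps {h : ℕ} {H₁ H₂ H₃ H₄ : Array Pt × Array Pt} {c : ℕ}
    (h₁ : ∀ q, (inHull H₁ q).steps ≤ c) (h₂ : ∀ q, (inHull H₂ q).steps ≤ c)
    (h₃ : ∀ q, (inHull H₃ q).steps ≤ c) (h₄ : ∀ q, (inHull H₄ q).steps ≤ c)
    (N : List (Item (h + 1))) :
    (keep H₁ H₂ H₃ H₄ N).steps ≤ (4 * c + 1) * N.length + 1 := by
  induction N with
  | nil => simp [keep]
  | cons e N ih =>
    simp only [keep, steps_bind, steps_tick, steps_ite, steps_pure, ite_self, List.length_cons,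
      Nat.mul_add]
    have a1 := h₁ e.rect.tl
    have a2 := h₂ e.rect.bl
    have a3 := h₃ e.rect.br
    have a4 := h₄ e.rect.tr
    omega

theorem discard_steps {h : ℕ} (B : Rect) (N : List (Item (h + 1))) {L : ℕ}
    (hL : 3 * (N.length + 1) ≤ 2 ^ L) : (discard B N).steps ≤ 1100 * ((N.length + 1) * L) := by
  have hlen : ∀ f g k : Rect → Pt, (gather f g k (B :: N.map Item.rect)).val.length =
      3 * (N.length + 1) := by
    intro f g k
    rw [gather_length, List.length_cons, List.length_map]
  have hclog : Nat.clog 2 (3 * (N.length + 1)) ≤ L := Nat.clog_le_of_le_pow hL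
  have hL1 : 1 ≤ L := by
    rcases Nat.eq_zero_or_pos L with rfl | h0
    · rw [pow_zero] at hL
      omega
    · exact h0
  have ha : ∀ f g k : Rect → Pt, (hullArrays (gather f g k (B :: N.map Item.rect)).val).steps ≤
      201 * ((N.length + 1) * L) := by
    intro f g k
    have := hullArrays_steps (gather f g k (B :: N.map Item.rect)).val
    rw [hlen] at this
    have e1 : 3 * (N.length + 1) * Nat.clog 2 (3 * (N.length + 1)) ≤
        3 * ((N.length + 1) * L) :=
      (Nat.mul_le_mul_left _ hclog).trans_eq (Nat.mul_assoc _ _ _)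
    have e2 : N.length + 1 ≤ (N.length + 1) * L := Nat.le_mul_of_pos_right _ hL1
    omega
  have hi : ∀ (f g k : Rect → Pt) (q : Pt),
      -- `49 = 12 + 37` from `inHull_steps`, using `1 ≤ L`; the factor `197` below is `4 * 49 + 1`.
      (inHull (hullArrays (gather f g k (B :: N.map Item.rect)).val).val q).steps ≤ 49 * L := by
    intro f g k q
    have := inHull_steps (gather f g k (B :: N.map Item.rect)).val q
    rw [hlen] at this
    omega
  simp only [discard, steps_bind, steps_tick, rects_steps, rects_val, gather_steps,
    List.length_cons, List.length_map]
  have k1 := keep_steps (hi Rect.bl Rect.br Rect.tr) (hi Rect.tl Rect.br Rect.tr)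
    (hi Rect.tl Rect.bl Rect.tr) (hi Rect.tl Rect.bl Rect.br) N
  have a1 := ha Rect.bl Rect.br Rect.tr
  have a2 := ha Rect.tl Rect.br Rect.tr
  have a3 := ha Rect.tl Rect.bl Rect.tr
  have a4 := ha Rect.tl Rect.bl Rect.br
  have e2 : N.length + 1 ≤ (N.length + 1) * L := Nat.le_mul_of_pos_right _ hL1
  have e3 : (4 * (49 * L) + 1) * N.length ≤ 197 * ((N.length + 1) * L) := by
    calc (4 * (49 * L) + 1) * N.length ≤ (197 * L) * (N.length + 1) :=
          Nat.mul_le_mul (by omega) (by omega)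
      _ = 197 * ((N.length + 1) * L) := by ring
  omega

theorem bound_steps (B : Rect) (N : List Rect) : (bound B N).steps = 5 * N.length + 1 := by
  induction N generalizing B with
  | nil => rfl
  | cons r N ih =>
    simp only [bound, steps_bind, steps_tick, steps_lt, ih, List.length_cons]
    omega

theorem boundingRect_steps (N : List Rect) : (boundingRect N).steps ≤ 5 * N.length + 2 := by
  cases N with
  | nil => simp [boundingRect]
  | cons r N =>
    simp only [boundingRect, steps_bind, steps_tick, bound_steps, List.length_cons]
    omega

end Timed

/-! ### Sizes of subtrees and the geometric series over the levels -/

namespace Item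

theorem two_pow_mul_length_le {h : ℕ} {N : List (Item h)}
    (hN : ∀ x ∈ N, 2 ^ h ≤ (points h x).length) :
    2 ^ h * N.length ≤ (N.flatMap (points h)).length := by
  rw [List.length_flatMap, mul_comm, ← smul_eq_mul]
  refine (List.card_nsmul_le_sum (N.map fun x => (points h x).length) (2 ^ h) ?_).trans' ?_
  · simpa using hN
  · simp

theorem Valid.two_pow_le {m M : ℕ} (hm : 2 ≤ m) : {h : ℕ} → {x : Item h} → Valid m M h x →
    2 ^ h ≤ (points h x).length
  | 0, _, _ => le_rfl
  | h + 1, e, he => by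
    have := two_pow_mul_length_le fun x hx => (he.2.2.2 x hx).two_pow_le hm
    refine le_trans ?_ this
    rw [pow_succ]
    exact Nat.mul_le_mul_left _ (hm.trans he.1)

end Item

namespace Timed

/-- Here `h` is the remaining height, while `w` and `L` stay fixed. A list at height `h + 1` has
length at most `w / 2 ^ (h + 1)`, exactly the increment of `w * (1 - 1 / 2 ^ h)`; the summand `h`
absorbs the constant overhead of each level. -/
theorem descend_steps {m M : ℕ} (hm : 2 ≤ m) (B : Rect) {L w : ℕ} (hL : 3 * (w + 1) ≤ 2 ^ L)
    (h : ℕ) (N : List (Item h)) (hN : ∀ x ∈ N, x.Valid m M h)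
    (hw : (N.flatMap (Item.points h)).length ≤ w) :
    ((descend B h N).steps : ℝ) ≤ 1110 * L * (w * (1 - 1 / 2 ^ h) + h) + 1 := by
  have hL1 : (1 : ℝ) ≤ L := by
    rcases Nat.eq_zero_or_pos L with rfl | h0
    · rw [pow_zero] at hL
      omega
    · exact_mod_cast h0
  induction h with
  | zero => simp [descend]
  | succ h ih =>
    have hd := discard_val B N fun e he => ((hN e he).tight hm).lo_le_hi
    have hK : ∀ e ∈ _root_.discard B N, e.Valid m M (h + 1) := fun e he =>
      hN e (mem_of_mem_discard he)
    have hK' := Item.Valid.children hK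
    have hlen := (discard_sublist B N).length_le
    have hsub := (Item.flatMap_points_sublist (discard_sublist B N)).length_le
    rw [← Item.flatMap_children_points (_root_.discard B N)] at hsub
    have ih := ih _ hK' (hsub.trans hw)
    have p1 := (Item.two_pow_mul_length_le fun x hx => (hN x hx).two_pow_le hm).trans hw
    have p2 := (Item.two_pow_mul_length_le fun x hx => (hK' x hx).two_pow_le hm).trans
      (hsub.trans hw)
    have hNw : N.length ≤ w := (Nat.le_mul_of_pos_left _ (by positivity)).trans p1
    have hds := discard_steps B N (L := L) (le_trans (by omega) hL)
    have hs : (descend B (h + 1) N).steps ≤ 1100 * ((N.length + 1) * L) + 3 * (N.length + 1) +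
        ((_root_.discard B N).flatMap Item.children).length +
        (descend B h ((_root_.discard B N).flatMap Item.children)).steps := by
      simp only [descend, steps_bind, steps_tick, steps_pure, hd, rects_steps, children_steps,
        children_val]
      omega
    generalize (descend B h ((_root_.discard B N).flatMap Item.children)).steps = d at *
    generalize ((_root_.discard B N).flatMap Item.children).length = k' at *
    generalize N.length = k at *
    have hpow : (0 : ℝ) < 2 ^ h := by positivity
    have q1 : (k : ℝ) ≤ w / 2 ^ (h + 1) := by
      rw [le_div_iff₀ (by positivity), mul_comm]
      exact_mod_cast p1
    -- The children are counted by the size of their subtrees, not by the fan-out, so `M` does not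
    -- enter. The level costs at most `1100 + 3 + 2` units of `(x + 1) * L`, below `1110`.
    have q2 : (k' : ℝ) ≤ 2 * (w / 2 ^ (h + 1)) := by
      have : 2 * ((w : ℝ) / 2 ^ (h + 1)) = w / 2 ^ h := by
        rw [pow_succ]; field_simp
      rw [this, le_div_iff₀ hpow, mul_comm]
      exact_mod_cast p2
    have hs' : ((descend B (h + 1) N).steps : ℝ) ≤ 1100 * ((k + 1) * L) + 3 * (k + 1) + k' + d := by
      exact_mod_cast hs
    have e1 : (w : ℝ) * (1 - 1 / 2 ^ h) = w * (1 - 1 / 2 ^ (h + 1)) - w / 2 ^ (h + 1) := by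
      rw [pow_succ]; field_simp; ring
    rw [e1] at ih
    push_cast
    have hx0 : (0 : ℝ) ≤ w / 2 ^ (h + 1) := by positivity
    generalize (w : ℝ) * (1 - 1 / 2 ^ (h + 1)) = y at *
    generalize (w : ℝ) / 2 ^ (h + 1) = x at *
    have e2 : (k + 1) * (L : ℝ) ≤ (x + 1) * L := by gcongr
    have e3 : x + 1 ≤ (x + 1) * L := le_mul_of_one_le_right (by linarith) hL1
    have e4 : 1110 * L * (y - x + h) + 1110 * ((x + 1) * L) = 1110 * (L : ℝ) * (y + (h + 1)) := by
      ring
    linarith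

end Timed

theorem natCast_clog_le {n : ℕ} (hn : 4 ≤ n) :
    (Nat.clog 2 (3 * (n + 1)) : ℝ) ≤ 4 * Real.log n := by
  have h1 : 2 ^ (Nat.clog 2 (3 * (n + 1)) - 1) < 3 * (n + 1) :=
    Nat.pow_pred_clog_lt_self one_lt_two (x := 3 * (n + 1)) (by omega)
  -- `3 * (n + 1) ≤ n ^ 2` holds from `n = 4` on.
  have h2 : 2 ^ (Nat.clog 2 (3 * (n + 1)) - 1) ≤ n ^ 2 := by nlinarith
  have hpos : 0 < Nat.clog 2 (3 * (n + 1)) := Nat.clog_pos one_lt_two (by omega)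
  obtain ⟨c, hc⟩ : ∃ c, Nat.clog 2 (3 * (n + 1)) = c + 1 := ⟨_, (Nat.succ_pred_eq_of_pos hpos).symm⟩
  rw [hc] at h2 ⊢
  rw [Nat.add_sub_cancel] at h2
  have h3 : (2 : ℝ) ^ c ≤ (n : ℝ) ^ 2 := by exact_mod_cast h2
  have h4 := Real.log_le_log (by positivity) h3
  rw [Real.log_pow, Real.log_pow] at h4
  have h5 : (4 : ℝ) ≤ n := by exact_mod_cast hn
  have h6 := Real.log_le_log (by norm_num) h5
  have h7 : Real.log 4 = 2 * Real.log 2 := by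
    rw [show (4 : ℝ) = 2 ^ 2 by norm_num, Real.log_pow]; norm_num
  have h8 := Real.log_two_gt_d9
  push_cast at h4 ⊢
  have h9 : (0 : ℝ) ≤ c := Nat.cast_nonneg c
  nlinarith

theorem timedConvexHull_steps {m M h n : ℕ} (hm : 2 ≤ m) {root : List (Item (h + 1))}
    (hroot : 2 ≤ root.length) (hN : ∀ e ∈ root, e.Valid m M (h + 1))
    (hn : (root.flatMap (Item.points (h + 1))).length = n) :
    ((timedConvexHull root).steps : ℝ) ≤ 12000 * (n * Real.log n) := by
  have p1 := Item.two_pow_mul_length_le fun x hx => (hN x hx).two_pow_le hm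
  rw [hn] at p1
  have hpow : h + 1 < 2 ^ (h + 1) := Nat.lt_two_pow_self
  -- At least two root entries with at least two points each.
  have hn4 : 4 ≤ n := by nlinarith [Nat.one_le_two_pow (n := h)]
  have hrn : root.length ≤ n := (Nat.le_mul_of_pos_left _ (by positivity)).trans p1
  -- A linear bound on the height is enough, as the height enters the cost only through `L * h`.
  have hhn : h + 1 ≤ n := by nlinarith
  set L := Nat.clog 2 (3 * (n + 1)) with hLdef
  have hL : 3 * (n + 1) ≤ 2 ^ L := Nat.le_pow_clog one_lt_two _
  have hL4 : (L : ℝ) ≤ 4 * Real.log n := natCast_clog_le hn4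
  have hL1 : 1 ≤ L := Nat.clog_pos one_lt_two (by omega)
  set B := (Timed.boundingRect (Timed.rects root).val).val with hB
  have hD := Timed.descend_steps hm B hL (h + 1) root hN hn.le
  set Q := (Timed.descend B (h + 1) root).val.2 with hQ
  have hQn : Q.length ≤ n := by
    rw [hQ, Timed.descend_val hm B (h + 1) root hN, ← hn]
    exact (descend_sublist B (h + 1) root).length_le
  have hpoly := Timed.polygon_steps Q
  have hclog : Nat.clog 2 Q.length ≤ L := Nat.clog_mono_right 2 (by omega)
  have hmul : Q.length * Nat.clog 2 Q.length ≤ n * L := Nat.mul_le_mul hQn hclog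
  have hb := Timed.boundingRect_steps (root.map Item.rect)
  rw [List.length_map] at hb
  have hs : (timedConvexHull root).steps ≤
      12 * (n * L) + 51 * n + 12 + (Timed.descend B (h + 1) root).steps := by
    have : (timedConvexHull root).steps = 1 + ((Timed.rects root).steps +
        ((Timed.boundingRect (Timed.rects root).val).steps +
          ((Timed.descend B (h + 1) root).steps + ((Timed.polygon Q).steps + 0)))) := rfl
    rw [this, Timed.rects_steps, Timed.rects_val]
    omega
  have hs' : ((timedConvexHull root).steps : ℝ) ≤
      12 * (n * L) + 51 * n + 12 + (Timed.descend B (h + 1) root).steps := by exact_mod_cast hs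
  have hL1' : (1 : ℝ) ≤ L := by exact_mod_cast hL1
  have hn4' : (4 : ℝ) ≤ n := by exact_mod_cast hn4
  have hhn' : ((h + 1 : ℕ) : ℝ) ≤ n := by exact_mod_cast hhn
  have e1 : (n : ℝ) * (1 - 1 / 2 ^ (h + 1)) ≤ n := by
    refine mul_le_of_le_one_right (by linarith) ?_
    have : (0 : ℝ) ≤ 1 / 2 ^ (h + 1) := by positivity
    linarith
  have e2 : 1110 * (L : ℝ) * (n * (1 - 1 / 2 ^ (h + 1)) + ((h + 1 : ℕ) : ℝ)) ≤
      1110 * L * (n + n) := by gcongr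
  have e3 : (n : ℝ) ≤ n * L := le_mul_of_one_le_right (by linarith) hL1'
  have e4 : (n : ℝ) * L ≤ n * (4 * Real.log n) := by gcongr
  have e5 : 1110 * (L : ℝ) * (n + n) = 2220 * (n * L) := by ring
  linarith

/-! ## The main theorem -/

theorem mainTheorem2 :
    ∃ C : ℝ, 0 < C ∧
      ∀ (m M h : ℕ) (P : Finset Pt) (root : List (Item (h + 1))), IsRTree m M P root →
        (timedConvexHull root).val.1 = hullAlgorithm root ∧
        Represents (timedConvexHull root).val.2
          (convexHull ℝ {p | p ∈ (hullAlgorithm root).2}) ∧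
        ((∀ e ∈ root, e.AllProper (h + 1)) →
          convexHull ℝ {p | p ∈ (hullAlgorithm root).2} = convexHull ℝ (P : Set Pt) ∧
          Represents (timedConvexHull root).val.2 (convexHull ℝ (P : Set Pt))) ∧
        ((timedConvexHull root).steps : ℝ) ≤ C * ((P.card : ℝ) * Real.log (P.card : ℝ)) := by
  refine ⟨12000, by norm_num, fun m M h P root hT => ?_⟩
  have hm := hT.two_le
  have hne : root ≠ [] := by
    rintro rfl
    have := hT.root_two_le
    simp at this
  have hP : (P : Set Pt) = Item.pointSet root := by
    ext p
    exact (hT.mem_points p).symm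
  have htight : ∀ e ∈ root, Tight e.rect {p | p ∈ e.points (h + 1)} := fun e he =>
    (hT.valid e he).tight hm
  have hB : (Timed.boundingRect (Timed.rects root).val).val = mbr (Item.cover root) := by
    rw [Timed.rects_val]
    exact Timed.boundingRect_val hne htight
  have hval : (timedConvexHull root).val =
      (hullAlgorithm root, (Timed.polygon (hullAlgorithm root).2).val) := by
    simp only [timedConvexHull, Timed.val_bind, Timed.val_pure, hB, hullAlgorithm]
    rw [Timed.descend_val hm _ _ _ hT.valid]
  have hsub : (hullAlgorithm root).2.Sublist (root.flatMap (Item.points (h + 1))) :=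
    descend_sublist _ _ _
  have hrep : Represents (timedConvexHull root).val.2
      (convexHull ℝ {p | p ∈ (hullAlgorithm root).2}) := by
    rw [hval]
    exact Timed.polygon_represents _ (hT.nodup.sublist hsub)
  refine ⟨by rw [hval], hrep, fun hprop => ?_, ?_⟩
  · have heq : convexHull ℝ {p | p ∈ (hullAlgorithm root).2} = convexHull ℝ (P : Set Pt) := by
      apply subset_antisymm
      · refine convexHull_mono fun p hp => ?_
        rw [hP]
        exact hsub.mem hp
      -- The hull is generated by its vertices, and each of these survives the descent.
      · rw [← convexHull_extremePoints_of_finite P.finite_toSet]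
        refine convexHull_mono fun p hp => ?_
        refine extremePoint_mem_descend hm P.finite_toSet ?_ (h + 1) root hT.valid hprop hT.nodup
          hP.ge hp ?_
        · rw [hP]
          exact Item.tight_mbr_cover hne htight
        · rw [← hP]
          exact extremePoints_convexHull_subset hp
    exact ⟨heq, heq ▸ hrep⟩
  · refine timedConvexHull_steps hm hT.root_two_le hT.valid ?_
    rw [← List.toFinset_card_of_nodup hT.nodup]
    congr 1
    ext p
    rw [List.mem_toFinset]
    exact hT.mem_points p
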